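/- Let $\mathbb{T}$ be a dependent type theory: a family of derivable judgements $(\Gamma)\ \mathcal{J}$, with $\mathcal J$ of one of the forms $A\in\mathrm{Type}$, $a\in A$, $A=B\in\mathrm{Type}$, $a=b\in A$, satisfying the usual presuppositions and closed under the structural rules (variables, weakening, substitution, definitional equality is an equivalence relation that is preserved by substitution, and elements and their equalities may be converted along definitional equality of types). Suppose that $\mathbb T$ has identity types in the following generalised form, relative to any context. If $a,b\in A$ then $\mathrm{Id}_A(a,b)\in\mathrm{Type}$; if $a\in A$ then $\mathrm r(a)\in\mathrm{Id}_A(a,a)$; if $p\in\mathrm{Id}_A(a,b)$, $\Theta(x,y,u)$ is a dependent context and $C(x,y,u)$ a type relative to $(x\in A,y\in A,u\in\mathrm{Id}_A(x,y),\Theta(x,y,u))$, and $(x\in A,\Theta(x,x,\mathrm r(x)))\ d(x)\in C(x,x,\mathrm r(x))$, then $(\Theta(a,b,p))\ \mathrm J(a,b,p,d)\in C(a,b,p)$, and $\mathrm J(a,a,\mathrm r(a),d)=d(a)$. Moreover $\mathrm{Id}$, $\mathrm r$ and $\mathrm J$ commute with substitution up to definitional equality. Let $\mathcal C(\mathbb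 T)$ be the classifying category: its objects are contexts up to renaming of variables and componentwise definitional equality, its maps are context morphisms up to pointwise definitional equality, and composition is substitution. A display map is a projection $(\Gamma,x\in A)\to\Gamma$, and a dependent projection is a projection $(\Gamma,\Phi)\to\Gamma$, where $\Phi$ is a dependent context relative to $\Gamma$. Let $\mathcal A$ be the class of maps having the left lifting property with respect to all display maps, and let $\mathcal B$ be the class of maps having the right lifting property with respect to all maps in $\mathcal A$. For a context $\Psi$, an identity context $\mathrm{Id}_\Psi(x,y)$, relative to $(x\in\Psi,y\in\Psi)$, together with reflexivity elements $\mathrm r(x)\in\mathrm{Id}_\Psi(x,x)$, is given by induction on the length of $\Psi$: it is empty if $\Psi$ is empty, and for $\Psi'=(x\in\Psi,x'\in A(x))$ $$\mathrm{Id}_{\Psi'}((x,x'),(y,y'))=(u\in\mathrm{Id}_\Psi(x,y),\ u'\in\mathrm{Id}_{A(y)}(u_!(x'),y')),\qquad \mathrm r(x,x')=(\mathrm r(x),\mathrm r(x')),$$ where $(x\in\Psi,y\in\Psi,u\in\mathrm{Id}_\Psi(x,y),z\in A(x))\ u_!(z)\in A(y)$ is any derivable transport term with $(\mathrm r(x))_!(z)=z\in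 A(x)$. Context morphisms $f,g:\Phi\to\Psi$ are pointwise propositionally equal if some judgement $(x\in\Phi)\ p(x)\in\mathrm{Id}_\Psi(f(x),g(x))$ is derivable. A path object of $Y$ is a factorisation $Y\xrightarrow{i}Y^I\xrightarrow{p}Y\times Y$ of the diagonal with $i\in\mathcal A$ and $p\in\mathcal B$, and $f,g:X\to Y$ are homotopic with respect to it if $(f,g)=p\circ h$ for some $h:X\to Y^I$. Then the following hold. 1. In $\mathcal C(\mathbb T)$, the pullback of any map along a dependent projection exists, and the pullback of an $\mathcal A$-map along a dependent projection is an $\mathcal A$-map. 2. Every object $Y$ of $\mathcal C(\mathbb T)$ has a path object, and for every path object of $Y$ and every object $X$ the homotopy relation on the maps $X\to Y$ is transitive. 3. Every context $\Psi$ has an identity context; and for every identity context of $\Psi$ and every path object of $\Psi$, two context morphisms $f,g:\Phi\to\Psi$ are homotopic if and only if they are pointwise propositionally equal. -/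

import Mathlib

open CategoryTheory CategoryTheory.Limits

universe u

namespace TypeTheory

/-! ### Expressions

Raw expressions, with variable binding, over an arbitrary signature; variables are de Bruijn
indices, so that expressions are automatically identified up to renaming of bound variables, and
contexts up to renaming of their variables. -/

/-- A signature: a symbol `o` takes `arity o` arguments and binds `binds o i` variables in the
`i`-th of them. -/
structure Signature where
  Op : Type u
  arity : Op → ℕ
  binds : (o : Op) → Fin (arity o) → ℕ

/-- Expressions in `n` free variables; the variable `0` is the one declared last. -/
inductive Expr (S : Signature.{u}) : ℕ → Type u
  | var {n : ℕ} (i : Fin n) : Expr S n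
  | op {n : ℕ} (o : S.Op) (args : (i : Fin (S.arity o)) → Expr S (n + S.binds o i)) : Expr S n

variable {S : Signature.{u}}

def liftRen {m n : ℕ} (ρ : Fin m → Fin n) : (k : ℕ) → Fin (m + k) → Fin (n + k)
  | 0 => ρ
  | k + 1 => Fin.cases 0 (fun i => (liftRen ρ k i).succ)

/-- Renaming of variables. -/
def Expr.ren {m : ℕ} : Expr S m → {n : ℕ} → (Fin m → Fin n) → Expr S n
  | .var i, _, ρ => .var (ρ i)
  | .op o args, _, ρ => .op o (fun i => (args i).ren (liftRen ρ (S.binds o i)))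

/-- Weakening by one variable. -/
def Expr.wk {n : ℕ} (e : Expr S n) : Expr S (n + 1) := e.ren Fin.succ

/-- `liftSub σ k` is the substitution `σ` extended by the identity on `k` new variables. -/
def liftSub {m n : ℕ} (σ : Fin m → Expr S n) : (k : ℕ) → Fin (m + k) → Expr S (n + k)
  | 0 => σ
  | k + 1 => Fin.cases (.var 0) (fun i => (liftSub σ k i).wk)

/-- Simultaneous substitution. -/
def Expr.subst {m : ℕ} : Expr S m → {n : ℕ} → (Fin m → Expr S n) → Expr S n
  | .var i, _, σ => σ i
  | .op o args, _, σ => .op o (fun i => (args i).subst (liftSub σ (S.binds o i)))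

/-- The substitution `(σ, e)`. -/
def scons {m n : ℕ} (e : Expr S n) (σ : Fin m → Expr S n) : Fin (m + 1) → Expr S n :=
  Fin.cases e σ

/-- The substitution `(σ, a)`, for a sequence `a` of `k` expressions. -/
def sappend {m n : ℕ} (σ : Fin m → Expr S n) :
    {k : ℕ} → (Fin k → Expr S n) → Fin (m + k) → Expr S n
  | 0, _ => σ
  | _ + 1, a => scons (a 0) (sappend σ (fun i => a i.succ))

/-! Basic facts on renaming and substitution. -/

theorem liftRen_comp {l m n : ℕ} (ρ : Fin l → Fin m) (ξ : Fin m → Fin n) (k : ℕ) :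
    (fun i => liftRen ξ k (liftRen ρ k i)) = liftRen (fun i => ξ (ρ i)) k := by
  induction k with
  | zero => rfl
  | succ k ih =>
    funext i
    refine Fin.cases rfl (fun i => ?_) i
    simpa [liftRen] using congrFun ih i

theorem Expr.ren_ren {l : ℕ} (e : Expr S l) : ∀ {m n : ℕ} (ρ : Fin l → Fin m) (ξ : Fin m → Fin n),
    (e.ren ρ).ren ξ = e.ren (fun i => ξ (ρ i)) := by
  induction e with
  | var i => intros; rfl
  | op o args ih =>
    intro m n ρ ξ
    simp only [Expr.ren, ih, liftRen_comp]

theorem liftSub_liftRen {l m n : ℕ} (ρ : Fin l → Fin m) (σ : Fin m → Expr S n) (k : ℕ) :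
    (fun i => liftSub σ k (liftRen ρ k i)) = liftSub (fun i => σ (ρ i)) k := by
  induction k with
  | zero => rfl
  | succ k ih =>
    funext i
    refine Fin.cases rfl (fun i => ?_) i
    simpa [liftRen, liftSub] using congrArg Expr.wk (congrFun ih i)

theorem Expr.subst_ren {l : ℕ} (e : Expr S l) :
    ∀ {m n : ℕ} (ρ : Fin l → Fin m) (σ : Fin m → Expr S n),
    (e.ren ρ).subst σ = e.subst (fun i => σ (ρ i)) := by
  induction e with
  | var i => intros; rfl
  | op o args ih =>
    intro m n ρ σ
    simp only [Expr.ren, Expr.subst, ih, liftSub_liftRen]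

theorem liftSub_ren {l m n : ℕ} (σ : Fin l → Expr S m) (ρ : Fin m → Fin n) (k : ℕ) :
    (fun i => (liftSub σ k i).ren (liftRen ρ k)) = liftSub (fun i => (σ i).ren ρ) k := by
  induction k with
  | zero => rfl
  | succ k ih =>
    funext i
    refine Fin.cases rfl (fun i => ?_) i
    have h := congrArg Expr.wk (congrFun ih i)
    simpa [liftRen, liftSub, Expr.wk, Expr.ren_ren] using h

theorem Expr.ren_subst {l : ℕ} (e : Expr S l) :
    ∀ {m n : ℕ} (σ : Fin l → Expr S m) (ρ : Fin m → Fin n),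
    (e.subst σ).ren ρ = e.subst (fun i => (σ i).ren ρ) := by
  induction e with
  | var i => intros; rfl
  | op o args ih =>
    intro m n σ ρ
    simp only [Expr.ren, Expr.subst, ih, liftSub_ren]

theorem liftSub_comp {l m n : ℕ} (σ : Fin l → Expr S m) (τ : Fin m → Expr S n) (k : ℕ) :
    (fun i => (liftSub σ k i).subst (liftSub τ k)) = liftSub (fun i => (σ i).subst τ) k := by
  induction k with
  | zero => rfl
  | succ k ih =>
    funext i
    refine Fin.cases rfl (fun i => ?_) i
    have h := congrArg Expr.wk (congrFun ih i)
    simpa [liftSub, Expr.wk, Expr.subst_ren, Expr.ren_subst] using h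

theorem Expr.subst_subst {l : ℕ} (e : Expr S l) :
    ∀ {m n : ℕ} (σ : Fin l → Expr S m) (τ : Fin m → Expr S n),
    (e.subst σ).subst τ = e.subst (fun i => (σ i).subst τ) := by
  induction e with
  | var i => intros; rfl
  | op o args ih =>
    intro m n σ τ
    simp only [Expr.subst, ih, liftSub_comp]

theorem liftSub_var (n k : ℕ) : liftSub (Expr.var : Fin n → Expr S n) k = Expr.var := by
  induction k with
  | zero => rfl
  | succ k ih =>
    funext i
    refine Fin.cases rfl (fun i => ?_) i
    simp [liftSub, ih, Expr.wk, Expr.ren]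

theorem Expr.subst_var {n : ℕ} (e : Expr S n) : e.subst Expr.var = e := by
  induction e with
  | var i => rfl
  | op o args ih => simp only [Expr.subst, liftSub_var, ih]

theorem Expr.wk_eq_subst {n : ℕ} (e : Expr S n) :
    e.wk = e.subst (fun i => Expr.var i.succ) := by
  conv_lhs => rw [← e.subst_var]
  rw [Expr.wk, Expr.ren_subst]
  rfl

/-! ### Contexts and judgements -/

/-- Sequences of `n` variable declarations `(x₀ ∈ A₀, …, xₙ₋₁ ∈ Aₙ₋₁(x₀, …, xₙ₋₂))`. -/
inductive Ctx (S : Signature.{u}) : ℕ → Type u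
  | nil : Ctx S 0
  | snoc {n : ℕ} (Γ : Ctx S n) (A : Expr S n) : Ctx S (n + 1)

/-- Sequences of `k` variable declarations relative to `n` variables declared before. -/
inductive Tele (S : Signature.{u}) (n : ℕ) : ℕ → Type u
  | nil : Tele S n 0
  | snoc {k : ℕ} (Φ : Tele S n k) (A : Expr S (n + k)) : Tele S n (k + 1)

/-- The concatenation `(Γ, Φ)`. -/
def Ctx.append {n : ℕ} (Γ : Ctx S n) : {k : ℕ} → Tele S n k → Ctx S (n + k)
  | _, .nil => Γ
  | _, .snoc Φ A => .snoc (Γ.append Φ) A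

def Tele.subst {m n : ℕ} (σ : Fin m → Expr S n) : {k : ℕ} → Tele S m k → Tele S n k
  | _, .nil => .nil
  | _, .snoc (k := k) Φ A => .snoc (Φ.subst σ) (A.subst (liftSub σ k))

/-- The type of the `i`-th variable of a context, as an expression in all of its variables. -/
def Ctx.get : {n : ℕ} → Ctx S n → Fin n → Expr S n
  | _, .nil => fun i => i.elim0
  | _, .snoc Γ A => Fin.cases A.wk (fun i => (Γ.get i).wk)

/-- The four forms of judgement: `A ∈ Type`, `a ∈ A`, `A = B ∈ Type` and `a = b ∈ A`. -/
inductive Judgement (S : Signature.{u}) (n : ℕ) : Type u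
  | isType (A : Expr S n)
  | isElem (a A : Expr S n)
  | eqType (A B : Expr S n)
  | eqElem (a b A : Expr S n)

def Judgement.subst {m n : ℕ} : Judgement S m → (Fin m → Expr S n) → Judgement S n
  | .isType A, σ => .isType (A.subst σ)
  | .isElem a A, σ => .isElem (a.subst σ) (A.subst σ)
  | .eqType A B, σ => .eqType (A.subst σ) (B.subst σ)
  | .eqElem a b A, σ => .eqElem (a.subst σ) (b.subst σ) (A.subst σ)

section

variable (D : ∀ {n : ℕ}, Ctx S n → Judgement S n → Prop)

/-- Well-formed contexts, with respect to a family `D` of derivable judgements. -/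
def Ctx.Wf : {n : ℕ} → Ctx S n → Prop
  | _, .nil => True
  | _, .snoc Γ A => Γ.Wf ∧ D Γ (.isType A)

/-- `σ = (b₀, …, bₘ₋₁)` is a context morphism `Γ ⟶ Δ = (y₀ ∈ B₀, …, yₘ₋₁ ∈ Bₘ₋₁)`, that is,
`(Γ) bᵢ ∈ Bᵢ(b₀, …, bᵢ₋₁)` for all `i`. -/
def IsMor {m n : ℕ} (Γ : Ctx S n) (Δ : Ctx S m) (σ : Fin m → Expr S n) : Prop :=
  ∀ i, D Γ (.isElem (σ i) ((Δ.get i).subst σ))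

/-- Pointwise definitional equality of context morphisms. -/
def MorEq {m n : ℕ} (Γ : Ctx S n) (Δ : Ctx S m) (σ τ : Fin m → Expr S n) : Prop :=
  ∀ i, D Γ (.eqElem (σ i) (τ i) ((Δ.get i).subst σ))

end

end TypeTheory

open TypeTheory

/-- A dependent type theory: the derivable judgements are closed under the structural rules.
Weakening and substitution for a single variable are combined into substitution along an arbitrary
context morphism. -/
structure DependentTypeTheory (S : Signature.{u}) where
  /-- `Derivable Γ 𝒥`: the judgement `(Γ) 𝒥` is derivable. -/
  Derivable : ∀ {n : ℕ}, Ctx S n → Judgement S n → Prop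
  -- presuppositions of the judgements
  wf_of_derivable : ∀ {n : ℕ} {Γ : Ctx S n} {J : Judgement S n}, Derivable Γ J → Γ.Wf Derivable
  isType_of_isElem : ∀ {n : ℕ} {Γ : Ctx S n} {a A : Expr S n},
    Derivable Γ (.isElem a A) → Derivable Γ (.isType A)
  isType_left : ∀ {n : ℕ} {Γ : Ctx S n} {A B : Expr S n},
    Derivable Γ (.eqType A B) → Derivable Γ (.isType A)
  isType_right : ∀ {n : ℕ} {Γ : Ctx S n} {A B : Expr S n},
    Derivable Γ (.eqType A B) → Derivable Γ (.isType B)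
  isElem_left : ∀ {n : ℕ} {Γ : Ctx S n} {a b A : Expr S n},
    Derivable Γ (.eqElem a b A) → Derivable Γ (.isElem a A)
  isElem_right : ∀ {n : ℕ} {Γ : Ctx S n} {a b A : Expr S n},
    Derivable Γ (.eqElem a b A) → Derivable Γ (.isElem b A)
  -- axiom, weakening and substitution
  var : ∀ {n : ℕ} {Γ : Ctx S n}, Γ.Wf Derivable → ∀ i, Derivable Γ (.isElem (.var i) (Γ.get i))
  subst : ∀ {m n : ℕ} {Γ : Ctx S n} {Δ : Ctx S m} {σ : Fin m → Expr S n} {J : Judgement S m},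
    Γ.Wf Derivable → IsMor Derivable Γ Δ σ → Derivable Δ J → Derivable Γ (J.subst σ)
  -- definitional equality is preserved by substitution
  subst_eqType : ∀ {m n : ℕ} {Γ : Ctx S n} {Δ : Ctx S m} {σ τ : Fin m → Expr S n} {A : Expr S m},
    Γ.Wf Derivable → IsMor Derivable Γ Δ σ → IsMor Derivable Γ Δ τ → MorEq Derivable Γ Δ σ τ →
    Derivable Δ (.isType A) → Derivable Γ (.eqType (A.subst σ) (A.subst τ))
  subst_eqElem : ∀ {m n : ℕ} {Γ : Ctx S n} {Δ : Ctx S m} {σ τ : Fin m → Expr S n} {a A : Expr S m},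
    Γ.Wf Derivable → IsMor Derivable Γ Δ σ → IsMor Derivable Γ Δ τ → MorEq Derivable Γ Δ σ τ →
    Derivable Δ (.isElem a A) → Derivable Γ (.eqElem (a.subst σ) (a.subst τ) (A.subst σ))
  -- definitional equality is an equivalence relation
  eqType_refl : ∀ {n : ℕ} {Γ : Ctx S n} {A : Expr S n},
    Derivable Γ (.isType A) → Derivable Γ (.eqType A A)
  eqType_symm : ∀ {n : ℕ} {Γ : Ctx S n} {A B : Expr S n},
    Derivable Γ (.eqType A B) → Derivable Γ (.eqType B A)
  eqType_trans : ∀ {n : ℕ} {Γ : Ctx S n} {A B C : Expr S n},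
    Derivable Γ (.eqType A B) → Derivable Γ (.eqType B C) → Derivable Γ (.eqType A C)
  eqElem_refl : ∀ {n : ℕ} {Γ : Ctx S n} {a A : Expr S n},
    Derivable Γ (.isElem a A) → Derivable Γ (.eqElem a a A)
  eqElem_symm : ∀ {n : ℕ} {Γ : Ctx S n} {a b A : Expr S n},
    Derivable Γ (.eqElem a b A) → Derivable Γ (.eqElem b a A)
  eqElem_trans : ∀ {n : ℕ} {Γ : Ctx S n} {a b c A : Expr S n},
    Derivable Γ (.eqElem a b A) → Derivable Γ (.eqElem b c A) → Derivable Γ (.eqElem a c A)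
  -- compatibility
  isElem_conv : ∀ {n : ℕ} {Γ : Ctx S n} {a A B : Expr S n},
    Derivable Γ (.isElem a A) → Derivable Γ (.eqType A B) → Derivable Γ (.isElem a B)
  eqElem_conv : ∀ {n : ℕ} {Γ : Ctx S n} {a b A B : Expr S n},
    Derivable Γ (.eqElem a b A) → Derivable Γ (.eqType A B) → Derivable Γ (.eqElem a b B)

namespace DependentTypeTheory

variable {S : Signature.{u}} (T : DependentTypeTheory S)

/-! ### The classifying category -/

abbrev Wf {n : ℕ} (Γ : Ctx S n) : Prop := Γ.Wf T.Derivable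

abbrev Mor {m n : ℕ} (Γ : Ctx S n) (Δ : Ctx S m) (σ : Fin m → Expr S n) : Prop :=
  IsMor T.Derivable Γ Δ σ

abbrev MorphismEq {m n : ℕ} (Γ : Ctx S n) (Δ : Ctx S m) (σ τ : Fin m → Expr S n) : Prop :=
  MorEq T.Derivable Γ Δ σ τ

/-- Componentwise definitional equality of contexts. -/
def CtxEq : {n : ℕ} → Ctx S n → Ctx S n → Prop
  | _, .nil, .nil => True
  | _, .snoc Γ A, .snoc Γ' A' => CtxEq Γ Γ' ∧ T.Derivable Γ (.eqType A A')

variable {T}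

theorem Mor.id {n : ℕ} {Γ : Ctx S n} (h : T.Wf Γ) : T.Mor Γ Γ Expr.var := by
  intro i
  rw [Expr.subst_var]
  exact T.var h i

theorem Mor.comp {l m n : ℕ} {Γ : Ctx S n} {Δ : Ctx S m} {Ξ : Ctx S l} {σ : Fin m → Expr S n}
    {τ : Fin l → Expr S m} (hΓ : T.Wf Γ) (hσ : T.Mor Γ Δ σ) (hτ : T.Mor Δ Ξ τ) :
    T.Mor Γ Ξ (fun i => (τ i).subst σ) := by
  intro i
  have h := T.subst hΓ hσ (hτ i)
  simpa [Judgement.subst, Expr.subst_subst] using h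

theorem Mor.wk {n : ℕ} {Γ : Ctx S n} {A : Expr S n} (h : T.Wf (Γ.snoc A)) :
    T.Mor (Γ.snoc A) Γ (fun i => Expr.var i.succ) := by
  intro i
  rw [← Expr.wk_eq_subst]
  exact T.var h i.succ

theorem Mor.wkAppend {n k : ℕ} {Γ : Ctx S n} (Φ : Tele S n k) (h : T.Wf (Γ.append Φ)) :
    T.Wf Γ ∧ T.Mor (Γ.append Φ) Γ (fun i => Expr.var (i.addNat k)) := by
  induction Φ with
  | nil => exact ⟨h, Mor.id h⟩
  | snoc Φ A ih => exact ⟨(ih h.1).1, Mor.comp h (Mor.wk h) (ih h.1).2⟩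

theorem MorphismEq.comp {l m n : ℕ} {Γ : Ctx S n} {Δ : Ctx S m} {Ξ : Ctx S l}
    {σ σ' : Fin m → Expr S n} {τ τ' : Fin l → Expr S m} (hΓ : T.Wf Γ)
    (hσ : T.Mor Γ Δ σ) (hσ' : T.Mor Γ Δ σ') (hτ : T.Mor Δ Ξ τ)
    (h : T.MorphismEq Γ Δ σ σ') (h' : T.MorphismEq Δ Ξ τ τ') :
    T.MorphismEq Γ Ξ (fun i => (τ i).subst σ) (fun i => (τ' i).subst σ') := by
  intro i
  have h1 := T.subst_eqElem hΓ hσ hσ' h (hτ i)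
  have h2 := T.subst hΓ hσ' (h' i)
  have h3 := T.subst_eqType hΓ hσ hσ' h (T.isType_of_isElem (hτ i))
  simp only [Judgement.subst, Expr.subst_subst] at h1 h2 h3
  exact T.eqElem_trans h1 (T.eqElem_conv h2 (T.eqType_symm h3))

theorem MorphismEq.refl {m n : ℕ} {Γ : Ctx S n} {Δ : Ctx S m} {σ : Fin m → Expr S n}
    (h : T.Mor Γ Δ σ) : T.MorphismEq Γ Δ σ σ := fun i => T.eqElem_refl (h i)

theorem MorphismEq.conv {m n : ℕ} {Γ : Ctx S n} {Δ : Ctx S m} {σ τ : Fin m → Expr S n}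
    (hΓ : T.Wf Γ) (hΔ : T.Wf Δ) (hσ : T.Mor Γ Δ σ) (hτ : T.Mor Γ Δ τ)
    (h : T.MorphismEq Γ Δ σ τ) (i : Fin m) :
    T.Derivable Γ (.eqType ((Δ.get i).subst σ) ((Δ.get i).subst τ)) :=
  T.subst_eqType hΓ hσ hτ h (T.isType_of_isElem (T.var hΔ i))

theorem MorphismEq.symm {m n : ℕ} {Γ : Ctx S n} {Δ : Ctx S m} {σ τ : Fin m → Expr S n}
    (hΓ : T.Wf Γ) (hΔ : T.Wf Δ) (hσ : T.Mor Γ Δ σ) (hτ : T.Mor Γ Δ τ)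
    (h : T.MorphismEq Γ Δ σ τ) : T.MorphismEq Γ Δ τ σ := fun i =>
  T.eqElem_conv (T.eqElem_symm (h i)) (MorphismEq.conv hΓ hΔ hσ hτ h i)

theorem MorphismEq.trans {m n : ℕ} {Γ : Ctx S n} {Δ : Ctx S m} {σ τ υ : Fin m → Expr S n}
    (hΓ : T.Wf Γ) (hΔ : T.Wf Δ) (hσ : T.Mor Γ Δ σ) (hτ : T.Mor Γ Δ τ)
    (h : T.MorphismEq Γ Δ σ τ) (h' : T.MorphismEq Γ Δ τ υ) : T.MorphismEq Γ Δ σ υ := fun i =>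
  T.eqElem_trans (h i)
    (T.eqElem_conv (h' i) (T.eqType_symm (MorphismEq.conv hΓ hΔ hσ hτ h i)))

/-- Definitionally equal contexts have the same derivable judgements. -/
theorem CtxEq.mor : ∀ {n : ℕ} {Γ Γ' : Ctx S n}, T.CtxEq Γ Γ' → T.Wf Γ → T.Wf Γ' →
    T.Mor Γ' Γ Expr.var
  | _, .nil, .nil, _, _, _ => fun i => i.elim0
  | _, .snoc Γ A, .snoc Γ' A', h, hΓ, hΓ' => by
    have ih := CtxEq.mor h.1 hΓ.1 hΓ'.1
    have hw := Mor.wk hΓ'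
    have hc := Mor.comp hΓ' hw ih
    intro i
    rw [Expr.subst_var]
    refine Fin.cases ?_ (fun i => ?_) i
    · have h1 : T.Derivable Γ' (.eqType A' A) := by
        have := T.subst hΓ'.1 ih h.2
        simp only [Judgement.subst, Expr.subst_var] at this
        exact T.eqType_symm this
      have h2 := T.subst hΓ' hw h1
      simp only [Judgement.subst, ← Expr.wk_eq_subst] at h2
      exact T.isElem_conv (T.var hΓ' 0) h2
    · have h2 : T.Derivable (Γ'.snoc A') (.isElem (.var i.succ)
          ((Γ.get i).subst (fun i => Expr.var i.succ))) := hc i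
      rwa [← Expr.wk_eq_subst] at h2

theorem CtxEq.derivable {n : ℕ} {Γ Γ' : Ctx S n} (h : T.CtxEq Γ Γ') (hΓ : T.Wf Γ)
    (hΓ' : T.Wf Γ') {J : Judgement S n} (hJ : T.Derivable Γ J) : T.Derivable Γ' J := by
  have h1 := T.subst hΓ' (h.mor hΓ hΓ') hJ
  cases J <;> simpa only [Judgement.subst, Expr.subst_var] using h1

theorem CtxEq.refl : ∀ {n : ℕ} {Γ : Ctx S n}, T.Wf Γ → T.CtxEq Γ Γ
  | _, .nil, _ => trivial
  | _, .snoc _ _, h => ⟨CtxEq.refl h.1, T.eqType_refl h.2⟩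

theorem CtxEq.symm : ∀ {n : ℕ} {Γ Γ' : Ctx S n}, T.Wf Γ → T.Wf Γ' → T.CtxEq Γ Γ' → T.CtxEq Γ' Γ
  | _, .nil, .nil, _, _, _ => trivial
  | _, .snoc _ _, .snoc _ _, h, h', e =>
    ⟨CtxEq.symm h.1 h'.1 e.1, e.1.derivable h.1 h'.1 (T.eqType_symm e.2)⟩

theorem CtxEq.trans : ∀ {n : ℕ} {Γ Γ' Γ'' : Ctx S n}, T.Wf Γ → T.Wf Γ' → T.CtxEq Γ Γ' →
    T.CtxEq Γ' Γ'' → T.CtxEq Γ Γ''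
  | _, .nil, .nil, .nil, _, _, _, _ => trivial
  | _, .snoc _ _, .snoc _ _, .snoc _ _, h, h', e, e' =>
    ⟨CtxEq.trans h.1 h'.1 e.1 e'.1,
      T.eqType_trans e.2 ((CtxEq.symm h.1 h'.1 e.1).derivable h'.1 h.1 e'.2)⟩

theorem CtxEq.mor_congr {m n : ℕ} {Γ Γ' : Ctx S n} {Δ Δ' : Ctx S m} (hΓ : T.Wf Γ) (hΓ' : T.Wf Γ')
    (hΔ : T.Wf Δ) (hΔ' : T.Wf Δ') (e : T.CtxEq Γ Γ') (e' : T.CtxEq Δ Δ') {σ : Fin m → Expr S n}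
    (h : T.Mor Γ Δ σ) : T.Mor Γ' Δ' σ := by
  have h1 := Mor.comp hΓ h ((CtxEq.symm hΔ hΔ' e').mor hΔ' hΔ)
  exact fun i => e.derivable hΓ hΓ' (h1 i)

theorem CtxEq.morphismEq_congr {m n : ℕ} {Γ Γ' : Ctx S n} {Δ Δ' : Ctx S m} (hΓ : T.Wf Γ)
    (hΓ' : T.Wf Γ') (hΔ : T.Wf Δ) (hΔ' : T.Wf Δ') (e : T.CtxEq Γ Γ') (e' : T.CtxEq Δ Δ')
    {σ τ : Fin m → Expr S n} (hσ : T.Mor Γ Δ σ) (hτ : T.Mor Γ Δ τ)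
    (h : T.MorphismEq Γ Δ σ τ) : T.MorphismEq Γ' Δ' σ τ := by
  have h0 := (CtxEq.symm hΔ hΔ' e').mor hΔ' hΔ
  have h1 := MorphismEq.comp hΓ hσ hτ h0 h (MorphismEq.refl h0)
  exact fun i => e.derivable hΓ hΓ' (h1 i)

variable (T)

/-- Well-formed contexts of length `n`, up to componentwise definitional equality. -/
def ctxSetoid (n : ℕ) : Setoid {Γ : Ctx S n // T.Wf Γ} where
  r Γ Γ' := T.CtxEq Γ.1 Γ'.1
  iseqv := ⟨fun Γ => CtxEq.refl Γ.2, fun {Γ Γ'} h => CtxEq.symm Γ.2 Γ'.2 h,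
    fun {Γ Γ' _} h h' => CtxEq.trans Γ.2 Γ'.2 h h'⟩

/-- Objects of the classifying category: equivalence classes of contexts. -/
structure ClassifyingCat where
  len : ℕ
  cls : Quotient (T.ctxSetoid len)

variable {T}

/-- `σ` is a context morphism between the contexts represented by `X` and `Y`. -/
def HomPred (X Y : ClassifyingCat T) (σ : Fin Y.len → Expr S X.len) : Prop :=
  Quotient.liftOn₂ X.cls Y.cls (fun Γ Δ => T.Mor Γ.1 Δ.1 σ)
    (fun Γ Δ Γ' Δ' e e' => propext
      ⟨CtxEq.mor_congr Γ.2 Γ'.2 Δ.2 Δ'.2 e e',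
        CtxEq.mor_congr Γ'.2 Γ.2 Δ'.2 Δ.2 (CtxEq.symm Γ.2 Γ'.2 e) (CtxEq.symm Δ.2 Δ'.2 e')⟩)

/-- Pointwise definitional equality of context morphisms between the contexts represented by `X`
and `Y`. -/
def HomEq (X Y : ClassifyingCat T) (σ τ : Fin Y.len → Expr S X.len) : Prop :=
  Quotient.liftOn₂ X.cls Y.cls
    (fun Γ Δ => T.Mor Γ.1 Δ.1 σ ∧ T.Mor Γ.1 Δ.1 τ ∧ T.MorphismEq Γ.1 Δ.1 σ τ)
    (fun Γ Δ Γ' Δ' e e' => propext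
      ⟨fun h => ⟨CtxEq.mor_congr Γ.2 Γ'.2 Δ.2 Δ'.2 e e' h.1,
          CtxEq.mor_congr Γ.2 Γ'.2 Δ.2 Δ'.2 e e' h.2.1,
          CtxEq.morphismEq_congr Γ.2 Γ'.2 Δ.2 Δ'.2 e e' h.1 h.2.1 h.2.2⟩,
        fun h => by
          have f := CtxEq.symm Γ.2 Γ'.2 e
          have f' := CtxEq.symm Δ.2 Δ'.2 e'
          exact ⟨CtxEq.mor_congr Γ'.2 Γ.2 Δ'.2 Δ.2 f f' h.1,
            CtxEq.mor_congr Γ'.2 Γ.2 Δ'.2 Δ.2 f f' h.2.1,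
            CtxEq.morphismEq_congr Γ'.2 Γ.2 Δ'.2 Δ.2 f f' h.1 h.2.1 h.2.2⟩⟩)

/-- Context morphisms up to pointwise definitional equality. -/
def homSetoid (X Y : ClassifyingCat T) :
    Setoid {σ : Fin Y.len → Expr S X.len // HomPred X Y σ} where
  r σ τ := HomEq X Y σ.1 τ.1
  iseqv := by
    obtain ⟨n, ⟨Γ⟩⟩ := X
    obtain ⟨m, ⟨Δ⟩⟩ := Y
    exact ⟨fun σ => ⟨σ.2, σ.2, MorphismEq.refl σ.2⟩,
      fun {σ τ} h => ⟨h.2.1, h.1, MorphismEq.symm Γ.2 Δ.2 h.1 h.2.1 h.2.2⟩,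
      fun {σ τ υ} h h' =>
        ⟨h.1, h'.2.1, MorphismEq.trans Γ.2 Δ.2 h.1 h.2.1 h.2.2 h'.2.2⟩⟩

theorem HomPred.id (X : ClassifyingCat T) : HomPred X X Expr.var := by
  obtain ⟨n, ⟨Γ⟩⟩ := X
  exact Mor.id Γ.2

theorem HomPred.comp {X Y Z : ClassifyingCat T} {σ : Fin Y.len → Expr S X.len}
    {τ : Fin Z.len → Expr S Y.len} (hσ : HomPred X Y σ) (hτ : HomPred Y Z τ) :
    HomPred X Z (fun i => (τ i).subst σ) := by
  obtain ⟨n, ⟨Γ⟩⟩ := X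
  obtain ⟨m, ⟨Δ⟩⟩ := Y
  obtain ⟨l, ⟨Ξ⟩⟩ := Z
  exact Mor.comp Γ.2 hσ hτ

theorem HomEq.comp {X Y Z : ClassifyingCat T} {σ σ' : Fin Y.len → Expr S X.len}
    {τ τ' : Fin Z.len → Expr S Y.len} (h : HomEq X Y σ σ') (h' : HomEq Y Z τ τ') :
    HomEq X Z (fun i => (τ i).subst σ) (fun i => (τ' i).subst σ') := by
  obtain ⟨n, ⟨Γ⟩⟩ := X
  obtain ⟨m, ⟨Δ⟩⟩ := Y
  obtain ⟨l, ⟨Ξ⟩⟩ := Z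
  exact ⟨Mor.comp Γ.2 h.1 h'.1, Mor.comp Γ.2 h.2.1 h'.2.1,
    MorphismEq.comp Γ.2 h.1 h.2.1 h'.1 h.2.2 h'.2.2⟩

/-- The classifying category: composition is substitution. -/
instance : Category.{u} (ClassifyingCat T) where
  Hom X Y := Quotient (homSetoid X Y)
  id X := Quotient.mk (homSetoid X X) ⟨Expr.var, HomPred.id X⟩
  comp {X Y Z} f g := Quotient.map₂ (sa := homSetoid X Y) (sb := homSetoid Y Z)
    (sc := homSetoid X Z) (fun σ τ => ⟨fun i => (τ.1 i).subst σ.1, HomPred.comp σ.2 τ.2⟩)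
    (fun _ _ h _ _ h' => HomEq.comp h h') f g
  id_comp {X Y} f := by
    induction f using Quotient.inductionOn with
    | _ σ =>
      refine congrArg (Quotient.mk (homSetoid X Y)) (Subtype.ext ?_)
      funext i
      exact Expr.subst_var _
  comp_id {X Y} f := by
    induction f using Quotient.inductionOn with
    | _ σ => exact congrArg (Quotient.mk (homSetoid X Y)) (Subtype.ext rfl)
  assoc {W X Y Z} f g h := by
    induction f using Quotient.inductionOn with
    | _ σ =>
    induction g using Quotient.inductionOn with
    | _ τ =>
    induction h using Quotient.inductionOn with
    | _ υ =>
      refine congrArg (Quotient.mk (homSetoid W Z)) (Subtype.ext ?_)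
      funext i
      exact (Expr.subst_subst _ _ _).symm

/-- The object of the classifying category given by a context. -/
def ob {n : ℕ} (Γ : Ctx S n) (h : T.Wf Γ) : ClassifyingCat T :=
  ⟨n, Quotient.mk (T.ctxSetoid n) ⟨Γ, h⟩⟩

/-- The map of the classifying category given by a context morphism. -/
def hom {m n : ℕ} {Γ : Ctx S n} {Δ : Ctx S m} (hΓ : T.Wf Γ) (hΔ : T.Wf Δ)
    (σ : Fin m → Expr S n) (hσ : T.Mor Γ Δ σ) : ob Γ hΓ ⟶ ob Δ hΔ :=
  Quotient.mk (homSetoid (ob Γ hΓ) (ob Δ hΔ)) ⟨σ, hσ⟩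

variable (T)

/-- Display maps `(Γ, x ∈ A) ⟶ Γ`. -/
inductive IsDisplayMap : ∀ ⦃X Y : ClassifyingCat T⦄, (X ⟶ Y) → Prop
  | mk {n : ℕ} (Γ : Ctx S n) (A : Expr S n) (h : T.Wf (Γ.snoc A)) :
      IsDisplayMap (hom h h.1 (fun i => Expr.var i.succ) (Mor.wk h))

/-- Dependent projections `(Γ, Φ) ⟶ Γ`. -/
inductive IsDependentProjection : ∀ ⦃X Y : ClassifyingCat T⦄, (X ⟶ Y) → Prop
  | mk {n k : ℕ} (Γ : Ctx S n) (Φ : Tele S n k) (h : T.Wf (Γ.append Φ)) :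
      IsDependentProjection
        (hom h (Mor.wkAppend Φ h).1 (fun i => Expr.var (i.addNat k)) (Mor.wkAppend Φ h).2)

/-- The class `𝒟` of display maps. -/
def displayMaps : MorphismProperty (ClassifyingCat T) := fun _ _ f => T.IsDisplayMap f

/-- The class `𝒜` of maps having the left lifting property with respect to display maps. -/
def classA : MorphismProperty (ClassifyingCat T) := T.displayMaps.llp

/-- The class `ℬ` of maps having the right lifting property with respect to `𝒜`-maps. -/
def classB : MorphismProperty (ClassifyingCat T) := T.classA.rlp

/-! ### Identity types -/

/-- The substitution `(a, b, p)` for the last three variables. -/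
def inst3 {n : ℕ} (a b p : Expr S n) : Fin (n + 3) → Expr S n :=
  scons p (scons b (scons a Expr.var))

/-- The axioms for identity types, including the commutation with substitution. The expression
`J A Θ C d a b p` is `J(a, b, p, d)`, an element of `C(a, b, p)` relative to `(Γ, Θ(a, b, p))`. -/
structure IdentityTypes where
  Id : ∀ {n : ℕ}, (A a b : Expr S n) → Expr S n
  refl : ∀ {n : ℕ}, (A a : Expr S n) → Expr S n
  J : ∀ {n k : ℕ}, (A : Expr S n) → (Θ : Tele S (n + 3) k) → (C : Expr S (n + 3 + k)) →
    (d : Expr S (n + 1 + k)) → (a b p : Expr S n) → Expr S (n + k)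
  formation : ∀ {n : ℕ} {Γ : Ctx S n} {A a b : Expr S n}, T.Derivable Γ (.isType A) →
    T.Derivable Γ (.isElem a A) → T.Derivable Γ (.isElem b A) →
    T.Derivable Γ (.isType (Id A a b))
  introduction : ∀ {n : ℕ} {Γ : Ctx S n} {A a : Expr S n}, T.Derivable Γ (.isElem a A) →
    T.Derivable Γ (.isElem (refl A a) (Id A a a))
  /-- In the premisses, `C` is a type relative to `(Γ, x ∈ A, y ∈ A, u ∈ Id(x, y), Θ(x, y, u))`, and
  `d` an element of `C(x, x, r(x))` relative to `(Γ, x ∈ A, Θ(x, x, r(x)))`. -/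
  elimination : ∀ {n k : ℕ} {Γ : Ctx S n} {A : Expr S n} {Θ : Tele S (n + 3) k}
    {C : Expr S (n + 3 + k)} {d : Expr S (n + 1 + k)} {a b p : Expr S n},
    T.Derivable Γ (.isElem a A) → T.Derivable Γ (.isElem b A) →
    T.Derivable Γ (.isElem p (Id A a b)) →
    T.Derivable (Ctx.append (((Γ.snoc A).snoc A.wk).snoc (Id A.wk.wk (.var 1) (.var 0))) Θ)
      (.isType C) →
    T.Derivable
      ((Γ.snoc A).append (Θ.subst (scons (refl A.wk (.var 0)) (scons (.var 0) Expr.var))))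
      (.isElem d (C.subst (liftSub (scons (refl A.wk (.var 0)) (scons (.var 0) Expr.var)) k))) →
    T.Derivable (Γ.append (Θ.subst (inst3 a b p)))
      (.isElem (J A Θ C d a b p) (C.subst (liftSub (inst3 a b p) k)))
  computation : ∀ {n k : ℕ} {Γ : Ctx S n} {A : Expr S n} {Θ : Tele S (n + 3) k}
    {C : Expr S (n + 3 + k)} {d : Expr S (n + 1 + k)} {a : Expr S n},
    T.Derivable Γ (.isElem a A) →
    T.Derivable (Ctx.append (((Γ.snoc A).snoc A.wk).snoc (Id A.wk.wk (.var 1) (.var 0))) Θ)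
      (.isType C) →
    T.Derivable
      ((Γ.snoc A).append (Θ.subst (scons (refl A.wk (.var 0)) (scons (.var 0) Expr.var))))
      (.isElem d (C.subst (liftSub (scons (refl A.wk (.var 0)) (scons (.var 0) Expr.var)) k))) →
    T.Derivable (Γ.append (Θ.subst (inst3 a a (refl A a))))
      (.eqElem (J A Θ C d a a (refl A a)) (d.subst (liftSub (scons a Expr.var) k))
        (C.subst (liftSub (inst3 a a (refl A a)) k)))
  Id_subst : ∀ {m n : ℕ} {Γ : Ctx S n} {Δ : Ctx S m} {σ : Fin n → Expr S m} {A a b : Expr S n},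
    T.Wf Δ → T.Mor Δ Γ σ → T.Derivable Γ (.isType A) →
    T.Derivable Γ (.isElem a A) → T.Derivable Γ (.isElem b A) →
    T.Derivable Δ (.eqType ((Id A a b).subst σ) (Id (A.subst σ) (a.subst σ) (b.subst σ)))
  refl_subst : ∀ {m n : ℕ} {Γ : Ctx S n} {Δ : Ctx S m} {σ : Fin n → Expr S m} {A a : Expr S n},
    T.Wf Δ → T.Mor Δ Γ σ → T.Derivable Γ (.isElem a A) →
    T.Derivable Δ (.eqElem ((refl A a).subst σ) (refl (A.subst σ) (a.subst σ))
      (Id (A.subst σ) (a.subst σ) (a.subst σ)))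
  J_subst : ∀ {m n k : ℕ} {Γ : Ctx S n} {Δ : Ctx S m} {σ : Fin n → Expr S m}
    {A : Expr S n} {Θ : Tele S (n + 3) k}
    {C : Expr S (n + 3 + k)} {d : Expr S (n + 1 + k)} {a b p : Expr S n},
    T.Wf Δ → T.Mor Δ Γ σ →
    T.Derivable Γ (.isElem a A) → T.Derivable Γ (.isElem b A) →
    T.Derivable Γ (.isElem p (Id A a b)) →
    T.Derivable (Ctx.append (((Γ.snoc A).snoc A.wk).snoc (Id A.wk.wk (.var 1) (.var 0))) Θ)
      (.isType C) →
    T.Derivable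
      ((Γ.snoc A).append (Θ.subst (scons (refl A.wk (.var 0)) (scons (.var 0) Expr.var))))
      (.isElem d (C.subst (liftSub (scons (refl A.wk (.var 0)) (scons (.var 0) Expr.var)) k))) →
    T.Derivable (Δ.append ((Θ.subst (inst3 a b p)).subst σ))
      (.eqElem ((J A Θ C d a b p).subst (liftSub σ k))
        (J (A.subst σ) (Θ.subst (liftSub σ 3)) (C.subst (liftSub (liftSub σ 3) k))
          (d.subst (liftSub (liftSub σ 1) k)) (a.subst σ) (b.subst σ) (p.subst σ))
        ((C.subst (liftSub (inst3 a b p) k)).subst (liftSub σ k)))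

/-! ### Identity contexts and propositional equality of context morphisms -/

/-- `(Γ) a ∈ Φ`: `a` is a dependent element of the dependent context `Φ` relative to `Γ`. -/
def IsDepElem {n : ℕ} (Γ : Ctx S n) : {k : ℕ} → Tele S n k → (Fin k → Expr S n) → Prop
  | _, .nil, _ => True
  | _, .snoc Φ A, a => IsDepElem Γ Φ (fun i => a i.succ) ∧
      T.Derivable Γ (.isElem (a 0) (A.subst (sappend Expr.var (fun i => a i.succ))))

end DependentTypeTheory

namespace TypeTheory

variable {S : Signature.{u}}

/-- A context regarded as a dependent context relative to `n` further variables. -/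
def Ctx.toTele (n : ℕ) : {k : ℕ} → Ctx S k → Tele S n k
  | _, .nil => .nil
  | _, .snoc (n := k) Γ A => .snoc (Γ.toTele n) (A.ren (Fin.castLE (Nat.le_add_left k n)))

/-- The context `(x ∈ Ψ, y ∈ Ψ)`. -/
def Ctx.dup {n : ℕ} (Ψ : Ctx S n) : Ctx S (n + n) := Ψ.append (Ψ.toTele n)

/-- The variables of the first part of `(Γ, Φ)`, where `Φ` has length `k`. -/
def fstVars (n k : ℕ) : Fin n → Expr S (n + k) := fun i => .var (i.addNat k)

/-- The variables of the second part of `(Γ, Φ)`, where `Φ` has length `k`. -/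
def sndVars (n k : ℕ) : Fin k → Expr S (n + k) := fun i => .var (i.castLE (Nat.le_add_left k n))

end TypeTheory

namespace DependentTypeTheory

variable {S : Signature.{u}} {T : DependentTypeTheory S}

/-- `E.IsIdentityContext Ψ I r`: the dependent context `I` relative to `(x ∈ Ψ, y ∈ Ψ)` is an
identity context `Id_Ψ(x, y)`, with reflexivity elements `(x ∈ Ψ) r(x) ∈ Id_Ψ(x, x)`. It is
constructed by induction on the length of `Ψ`: for `Ψ' = (x ∈ Ψ, x' ∈ A(x))`,
`Id_Ψ'((x, x'), (y, y')) = (u ∈ Id_Ψ(x, y), u' ∈ Id_{A(y)}(u_!(x'), y'))`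
where the transport `u_!(z) ∈ A(y)`, for `x, y ∈ Ψ`, `u ∈ Id_Ψ(x, y)` and `z ∈ A(x)`, satisfies
`(r(x))_!(z) = z ∈ A(x)`. Below, `t` is `u_!(z)`. -/
inductive IdentityTypes.IsIdentityContext (E : T.IdentityTypes) :
    ∀ {n : ℕ}, Ctx S n → Tele S (n + n) n → (Fin n → Expr S n) → Prop
  | nil : E.IsIdentityContext Ctx.nil Tele.nil Fin.elim0
  | snoc {n : ℕ} {Ψ : Ctx S n} {I : Tele S (n + n) n} {r : Fin n → Expr S n}
      (h : E.IsIdentityContext Ψ I r) (A : Expr S n) (t : Expr S (n + n + n + 1))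
      (ht : T.Derivable
        ((Ψ.dup.append I).snoc
          (A.subst (fun i => .var ((i.addNat n).addNat n))))
        (.isElem t
          (A.subst (fun i => .var (((i.castLE (Nat.le_add_left n n)).addNat n).succ)))))
      (ht_refl : T.Derivable (Ψ.snoc A)
        (.eqElem
          (t.subst (scons (.var 0)
            (sappend (sappend (fun i => .var i.succ) (fun i => .var i.succ)) (fun i => (r i).wk))))
          (.var 0) A.wk)) :
      E.IsIdentityContext (Ψ.snoc A)
        (Tele.snoc
          (I.subst (sappend (fun i => fstVars (n + 1) (n + 1) i.succ)
            (fun i => sndVars (n + 1) (n + 1) i.succ)))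
          (E.Id
            (A.subst (fun i => (sndVars (n + 1) (n + 1) i.succ).ren (Fin.addNat · n)))
            (t.subst (scons ((fstVars (n + 1) (n + 1) 0).ren (Fin.addNat · n))
              (sappend
                (sappend
                  (fun i => (fstVars (n + 1) (n + 1) i.succ).ren (Fin.addNat · n))
                  (fun i => (sndVars (n + 1) (n + 1) i.succ).ren (Fin.addNat · n)))
                (sndVars (n + 1 + (n + 1)) n))))
            ((sndVars (n + 1) (n + 1) 0).ren (Fin.addNat · n))))
        (scons (E.refl A.wk (.var 0)) (fun i => (r i).wk))

/-- Pointwise propositional equality of the context morphisms `f` and `g` from `Φ` to a context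
with identity context `I`: there is `(x ∈ Φ) p(x) ∈ I(f(x), g(x))`. -/
def PropositionallyEqual (T : DependentTypeTheory S) {m n : ℕ} (Φ : Ctx S m)
    (I : Tele S (n + n) n) (f g : Fin n → Expr S m) : Prop :=
  ∃ p : Fin n → Expr S m, T.IsDepElem Φ (I.subst (sappend f g)) p

end DependentTypeTheory

/-! ### The homotopy relation induced by a pair of classes of maps -/

/-- A factorisation `Y ⟶ Yᴵ ⟶ Y × Y` of the diagonal of `Y` as an `𝒜`-map followed by a
`ℬ`-map. -/
structure PathObject {C : Type*} [Category C] (𝒜 ℬ : MorphismProperty C) (Y : C) where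
  prod : C
  π₁ : prod ⟶ Y
  π₂ : prod ⟶ Y
  isProduct : IsLimit (BinaryFan.mk π₁ π₂)
  path : C
  i : Y ⟶ path
  p : path ⟶ prod
  fac₁ : i ≫ p ≫ π₁ = 𝟙 Y
  fac₂ : i ≫ p ≫ π₂ = 𝟙 Y
  mem_i : 𝒜 i
  mem_p : ℬ p

/-- `f` and `g` are homotopic with respect to the given factorisation of the diagonal. -/
def PathObject.Homotopic {C : Type*} [Category C] {𝒜 ℬ : MorphismProperty C} {Y : C}
    (P : PathObject 𝒜 ℬ Y) {X : C} (f g : X ⟶ Y) : Prop :=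
  ∃ h : X ⟶ P.path, h ≫ P.p ≫ P.π₁ = f ∧ h ≫ P.p ≫ P.π₂ = g

/-! Display maps and isomorphisms generate a class `Fib` of fibrations. Up to isomorphism these are
the dependent projections. They are stable under base change because substitution is pullback, and
every object is fibrant over the empty context. `𝒜`-maps lift against all fibrations, so fibrations
are `ℬ`-maps. A map is called good if its pullbacks along fibrations are still `𝒜`-maps.

The type-theoretic input is that the reflexivity map `(Γ, x) ⟶ (Γ, x, y, u)` is good: the lifting
property after pullback along a dependent projection is exactly J with a dependent context `Θ`
(`good_diagSub`). This extends to contexts by induction (`IsGoodIdentity.snoc`). The reflexivity map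
of `(Ψ, A)` is the one of `A` relative to `Ψ`, followed by a pullback of the one of `Ψ` along a
fibration; that pullback is recognised by means of `r(x)_!(x') = x'`. Goodness in turn produces
transport terms (`IsGoodIdentity.exists_transport`), so identity contexts exist, and every diagonal
factors as a good map followed by a fibration (`GoodPath`).

The rest is abstract. Homotopies compose because the relevant pullback of a good map lifts against
the path fibration (`homotopic_trans`). Since all objects are fibrant, an arbitrary `𝒜`-map `i` is
the inclusion of a strong deformation retract: it has a retraction `k` and a homotopy from `k ≫ i`
to the identity that is constant along `i`. Transport along this homotopy carries the retraction to
any pullback of `i` along a fibration, and a second transport, in the display map to be lifted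
against, corrects the resulting map to a filler (`good_of_llp`). Hence every `𝒜`-map is good.
Finally, any two path objects are compared by lifting (`homotopic_of_homotopic`), so homotopy can be
computed with an identity context, where a homotopy is a context morphism `(f, g, p)`, that is, a
pointwise propositional equality (`identityPath_homotopic_iff`). -/

/-! ### Fibrations generated by a class of display maps -/

namespace DisplayClass

universe v w

variable {C : Type w} [Category.{v} C]

/-- The closure of `D` and the isomorphisms under composition. -/
inductive Fib (D : MorphismProperty C) : ∀ {X Y : C}, (X ⟶ Y) → Prop
  | id (X : C) : Fib D (𝟙 X)
  | iso_comp {X Y Z : C} (e : X ⟶ Y) (f : Y ⟶ Z) : IsIso e → Fib D f → Fib D (e ≫ f)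
  | comp {X Y Z : C} (d : X ⟶ Y) (f : Y ⟶ Z) : D d → Fib D f → Fib D (d ≫ f)

/-- Pullbacks of `D`-maps along arbitrary maps exist, and can be chosen in `D`. -/
def HasBaseChange (D : MorphismProperty C) : Prop :=
  ∀ ⦃X Y Z : C⦄ (f : X ⟶ Z) (d : Y ⟶ Z), D d →
    ∃ (P : C) (q : P ⟶ X) (g : P ⟶ Y), D q ∧ IsPullback q g f d

/-- All pullbacks of `f` along fibrations have the left lifting property with respect to `D`. -/
def Good (D : MorphismProperty C) {X Z : C} (f : X ⟶ Z) : Prop :=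
  ∀ ⦃P Y : C⦄ (q : P ⟶ X) (g : P ⟶ Y) (p : Y ⟶ Z), Fib D p → IsPullback q g f p → D.llp g

variable {D : MorphismProperty C}

/-! ### Closure and lifting properties of fibrations -/

namespace Fib

theorem of_isIso {X Y : C} (e : X ⟶ Y) [h : IsIso e] : Fib D e := by
  simpa using Fib.iso_comp e _ h (Fib.id Y)

theorem of_mem {X Y : C} (d : X ⟶ Y) (h : D d) : Fib D d := by
  simpa using Fib.comp d _ h (Fib.id Y)

theorem trans {X Y Z : C} {f : X ⟶ Y} {g : Y ⟶ Z} (hf : Fib D f) (hg : Fib D g) :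
    Fib D (f ≫ g) := by
  induction hf with
  | id => simpa using hg
  | iso_comp e f he _ ih => simpa using Fib.iso_comp e _ he (ih hg)
  | comp d f hd _ ih => simpa using Fib.comp d _ hd (ih hg)

theorem exists_isPullback (hD : HasBaseChange D) {X Y Z : C} (f : X ⟶ Z) {p : Y ⟶ Z}
    (hp : Fib D p) : ∃ (P : C) (q : P ⟶ X) (g : P ⟶ Y), Fib D q ∧ IsPullback q g f p := by
  induction hp with
  | id => exact ⟨X, 𝟙 X, f, Fib.id X, IsPullback.of_id_fst⟩
  | iso_comp e p he _ ih =>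
    obtain ⟨P, q, g, hq, h⟩ := ih f
    refine ⟨P, q, g ≫ inv e, hq, ?_⟩
    simpa using (IsPullback.of_horiz_isIso (fst := 𝟙 P) (snd := g ≫ inv e) (f := g) (g := e)
      ⟨by simp⟩).paste_horiz h
  | comp d p hd _ ih =>
    obtain ⟨P, q, g, hq, h⟩ := ih f
    obtain ⟨P', q', g', hq', h'⟩ := hD g d hd
    exact ⟨P', q' ≫ q, g', Fib.comp _ _ hq' hq, h'.paste_horiz h⟩

theorem of_isPullback (hD : HasBaseChange D) {P X Y Z : C} {q : P ⟶ X} {g : P ⟶ Y} {f : X ⟶ Z}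
    {p : Y ⟶ Z} (h : IsPullback q g f p) (hp : Fib D p) : Fib D q := by
  obtain ⟨P', q', g', hq', h'⟩ := exists_isPullback hD f hp
  have : q = (h.isoIsPullback _ _ h').hom ≫ q' := by simp
  rw [this]
  exact (of_isIso _).trans hq'

theorem hasLiftingProperty {X Y : C} {p : X ⟶ Y} (hp : Fib D p) {U V : C} {i : U ⟶ V}
    (hi : D.llp i) : HasLiftingProperty i p := by
  induction hp with
  | id => infer_instance
  | iso_comp e p he _ ih => infer_instance
  | comp d p hd _ ih =>
    have := hi d hd
    infer_instance

theorem mem_rlp {X Y : C} {p : X ⟶ Y} (hp : Fib D p) : D.llp.rlp p :=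
  fun _ _ _ hi => hp.hasLiftingProperty hi

end Fib

/-! ### Closure properties of good maps -/

namespace Good

theorem llp {X Z : C} {f : X ⟶ Z} (hf : Good D f) : D.llp f :=
  hf (𝟙 X) f (𝟙 Z) (Fib.id Z) IsPullback.of_id_fst

/-- Pulling back in two stages writes a pullback of the composite as a pullback of `f` followed by a
pullback of `g`. The first is again taken along a fibration, since base change preserves these. -/
theorem trans (hD : HasBaseChange D) {X Y Z : C} {f : X ⟶ Y} {g : Y ⟶ Z} (hf : Good D f)
    (hg : Good D g) : Good D (f ≫ g) := by
  intro P E q k p hp h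
  obtain ⟨E', q', g', hq', h'⟩ := Fib.exists_isPullback hD g hp
  have hk : h'.lift (q ≫ f) k (by simp [h.w]) ≫ g' = k := by simp
  rw [← hk]
  have h1 : IsPullback (h'.lift (q ≫ f) k (by simp [h.w])) q q' f := by
    refine IsPullback.of_right (h₁₂ := g') (v₁₃ := p) (h₂₂ := g) ?_ (by simp) h'.flip
    simpa using h.flip
  exact D.llp.comp_mem _ _ (hf q _ q' hq' h1.flip) (hg q' g' p hp h')

theorem of_isPullback {P X Y Z : C} {q : P ⟶ X} {g : P ⟶ Y} {f : X ⟶ Z} {p : Y ⟶ Z}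
    (hf : Good D f) (h : IsPullback q g f p) (hp : Fib D p) : Good D g := by
  intro P' Y' q' g' p' hp' h'
  exact hf (q' ≫ q) g' (p' ≫ p) (hp'.trans hp) (h'.paste_horiz h)

end Good

/-- A factorisation of the diagonal of `V` as a good map followed by a fibration. -/
structure GoodPath (D : MorphismProperty C) (V : C) where
  prod : C
  π₁ : prod ⟶ V
  π₂ : prod ⟶ V
  isProduct : IsLimit (BinaryFan.mk π₁ π₂)
  path : C
  r : V ⟶ path
  p : path ⟶ prod
  fac₁ : r ≫ p ≫ π₁ = 𝟙 V
  fac₂ : r ≫ p ≫ π₂ = 𝟙 V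
  good : Good D r
  fib : Fib D p

/-! ### Consequences of a good path object: composition of homotopies, and stability of maps with
the left lifting property -/

namespace GoodPath

variable {V : C} (Q : GoodPath D V)

/-- The path object underlying a `GoodPath`. -/
def toPathObject : PathObject D.llp D.llp.rlp V where
  prod := Q.prod
  π₁ := Q.π₁
  π₂ := Q.π₂
  isProduct := Q.isProduct
  path := Q.path
  i := Q.r
  p := Q.p
  fac₁ := Q.fac₁
  fac₂ := Q.fac₂
  mem_i := Q.good.llp
  mem_p := Q.fib.mem_rlp

theorem prod_hom_ext {W : C} {f g : W ⟶ Q.prod} (h₁ : f ≫ Q.π₁ = g ≫ Q.π₁)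
    (h₂ : f ≫ Q.π₂ = g ≫ Q.π₂) : f = g :=
  BinaryFan.IsLimit.hom_ext Q.isProduct h₁ h₂

theorem exists_prod_lift {W : C} (f g : W ⟶ V) :
    ∃ l : W ⟶ Q.prod, l ≫ Q.π₁ = f ∧ l ≫ Q.π₂ = g :=
  ⟨(BinaryFan.IsLimit.lift' Q.isProduct f g).1, (BinaryFan.IsLimit.lift' Q.isProduct f g).2⟩

/-- The source map of the path object. -/
abbrev src : Q.path ⟶ V := Q.p ≫ Q.π₁

/-- The target map of the path object. -/
abbrev tgt : Q.path ⟶ V := Q.p ≫ Q.π₂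

/-- The projection `π₁` is the base change of the map from `V` to the terminal object. -/
theorem fib_src (hD : HasBaseChange D) {O : C} (hO : IsTerminal O)
    (hV : ∀ f : V ⟶ O, Fib D f) : Fib D Q.src :=
  Q.fib.trans (Fib.of_isPullback hD (IsPullback.of_is_product' Q.isProduct hO) (hV _))

/-- Composition of paths is defined on the object `N` of composable pairs by lifting from the pairs
whose first path is reflexivity, where the composite is the second path. -/
theorem homotopic_trans (hD : HasBaseChange D) {O : C} (hO : IsTerminal O)
    (hV : ∀ f : V ⟶ O, Fib D f) {X : C} {f g h : X ⟶ V} :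
    Q.toPathObject.Homotopic f g → Q.toPathObject.Homotopic g h →
      Q.toPathObject.Homotopic f h := by
  rintro ⟨(a : X ⟶ Q.path), ha₁, ha₂⟩ ⟨(b : X ⟶ Q.path), hb₁, hb₂⟩
  change a ≫ Q.src = f at ha₁
  change a ≫ Q.tgt = g at ha₂
  change b ≫ Q.src = g at hb₁
  change b ≫ Q.tgt = h at hb₂
  obtain ⟨N, n₁, n₂, hn, hN⟩ := Fib.exists_isPullback hD Q.tgt (Q.fib_src hD hO hV)
  let ρ : Q.path ⟶ N := hN.lift (Q.src ≫ Q.r) (𝟙 _) (by simp [Q.fac₂])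
  -- Pasting with the pullback defining `N` gives the trivial square over `r ≫ tgt = 𝟙`. So `ρ` is
  -- the base change of the good map `r` along the fibration `n₁`.
  have hρ : IsPullback Q.src ρ Q.r n₁ := by
    have h1 : IsPullback (ρ ≫ n₂) Q.src Q.src (Q.r ≫ Q.tgt) := by
      rw [hN.lift_snd, show Q.r ≫ Q.tgt = 𝟙 V from Q.fac₂]
      exact IsPullback.of_id_fst
    exact (IsPullback.of_right h1 (by simp [ρ]) hN.flip).flip
  have hρ' := Q.good _ _ _ hn hρ
  have := Q.fib.hasLiftingProperty hρ'
  obtain ⟨l, hl₁, hl₂⟩ := Q.exists_prod_lift (n₁ ≫ Q.src) (n₂ ≫ Q.tgt)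
  have sq : CommSq (𝟙 Q.path) ρ Q.p l := ⟨Q.prod_hom_ext
    (by
      simp only [Category.id_comp, Category.assoc, hl₁]
      rw [hN.lift_fst_assoc, Category.assoc]
      simp [Q.fac₁])
    (by
      simp only [Category.id_comp, Category.assoc, hl₂]
      rw [hN.lift_snd_assoc, Category.id_comp])⟩
  refine ⟨hN.lift a b (ha₂.trans hb₁.symm) ≫ sq.lift, ?_, ?_⟩
  · change (hN.lift a b (ha₂.trans hb₁.symm) ≫ sq.lift) ≫ Q.p ≫ Q.π₁ = f
    rw [Category.assoc, sq.fac_right_assoc, hl₁, hN.lift_fst_assoc, ha₁]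
  · change (hN.lift a b (ha₂.trans hb₁.symm) ≫ sq.lift) ≫ Q.p ≫ Q.π₂ = h
    rw [Category.assoc, sq.fac_right_assoc, hl₂, hN.lift_snd_assoc, hb₂]

/-- Maps with the left lifting property are stable under pullback along fibrations. -/
theorem good_of_llp (Q : GoodPath D V) (hD : HasBaseChange D) {O : C} (hO : IsTerminal O)
    (hX : ∀ {X : C} (f : X ⟶ O), Fib D f) {U : C} {i : U ⟶ V} (hi : D.llp i) : Good D i := by
  -- Fibrancy of `U` extends its identity along `i`, which gives the retraction `k`.
  have lU := (hX (hO.from U)).hasLiftingProperty hi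
  have sqU : CommSq (𝟙 U) i (hO.from U) (hO.from V) := ⟨hO.hom_ext _ _⟩
  obtain ⟨k, hk⟩ : ∃ k : V ⟶ U, i ≫ k = 𝟙 U := ⟨sqU.lift, sqU.fac_left⟩
  obtain ⟨l, hl₁, hl₂⟩ := Q.exists_prod_lift (k ≫ i) (𝟙 V)
  have lp := Q.fib.hasLiftingProperty hi
  -- Lifting `i` against the path fibration yields a homotopy `H` from `k ≫ i` to `𝟙 V` which is
  -- reflexivity on `U`.
  have sqH : CommSq (i ≫ Q.r) i Q.p l := ⟨Q.prod_hom_ext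
    (by simp [hl₁, Q.fac₁, reassoc_of% hk]) (by simp [hl₂, Q.fac₂])⟩
  obtain ⟨H, hH, hHs, hHt⟩ : ∃ H : V ⟶ Q.path, i ≫ H = i ≫ Q.r ∧ H ≫ Q.src = k ≫ i ∧
      H ≫ Q.tgt = 𝟙 V :=
    ⟨sqH.lift, sqH.fac_left, by rw [sqH.fac_right_assoc, hl₁], by rw [sqH.fac_right_assoc, hl₂]⟩
  intro U' E q g e he hg A B d hd
  refine ⟨fun {a b} sq => ?_⟩
  -- `N` consists of a path in `V` and a point of `E` over its target. Its map `ρ` inserts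
  -- reflexivity paths and is good, being a pullback of `r` along a fibration.
  obtain ⟨N, nP, nE, hn, hN⟩ := Fib.exists_isPullback hD Q.tgt he
  let ρ : E ⟶ N := hN.lift (e ≫ Q.r) (𝟙 E) (by simp [Q.fac₂])
  have hρP : ρ ≫ nP = e ≫ Q.r := hN.lift_fst _ _ _
  have hρE : ρ ≫ nE = 𝟙 E := hN.lift_snd _ _ _
  have hρ : IsPullback e ρ Q.r nP := by
    have h1 : IsPullback (ρ ≫ nE) e e (Q.r ≫ Q.tgt) := by
      rw [hρE, show Q.r ≫ Q.tgt = 𝟙 V from Q.fac₂]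
      exact IsPullback.of_id_fst
    exact (IsPullback.of_right h1 hρP hN.flip).flip
  have gρ : Good D ρ := Q.good.of_isPullback hρ hn
  have le := he.hasLiftingProperty gρ.llp
  -- Backward transport `tr`: a point over the target of a path is moved to one over its source, and
  -- `tr` is the identity on reflexivity paths.
  have sqt : CommSq (𝟙 E) ρ e (nP ≫ Q.src) := ⟨by
    rw [reassoc_of% hρP, Q.fac₁]; simp⟩
  obtain ⟨tr, htr, htre⟩ : ∃ tr : N ⟶ E, ρ ≫ tr = 𝟙 E ∧ tr ≫ e = nP ≫ Q.src :=
    ⟨sqt.lift, sqt.fac_left, sqt.fac_right⟩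
  let H' : E ⟶ N := hN.lift (e ≫ H) (𝟙 E) (by rw [Category.assoc, hHt]; simp)
  have hHP : H' ≫ nP = e ≫ H := hN.lift_fst _ _ _
  have hHE : H' ≫ nE = 𝟙 E := hN.lift_snd _ _ _
  have hgH : g ≫ H' = g ≫ ρ := hN.hom_ext
    (by rw [Category.assoc, Category.assoc, hHP, hρP, ← reassoc_of% hg.w, ← reassoc_of% hg.w, hH])
    (by rw [Category.assoc, Category.assoc, hHE, hρE])
  -- Transporting a point of `E` back along `H` puts it over `k ≫ i`, hence in the pullback `U'`.
  -- This is a retraction of `g` because `H` is reflexivity on `U`.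
  let k' : E ⟶ U' := hg.lift (e ≫ k) (H' ≫ tr) (by
    rw [Category.assoc, Category.assoc, htre, reassoc_of% hHP, hHs])
  have hk'g : k' ≫ g = H' ≫ tr := hg.lift_snd _ _ _
  have hgk' : g ≫ k' = 𝟙 U' := hg.hom_ext
    (by
      rw [Category.assoc, hg.lift_fst, ← reassoc_of% hg.w, hk]; simp)
    (by rw [Category.assoc, hk'g, reassoc_of% hgH, htr]; simp)
  -- The candidate `k' ≫ a` lies over `H' ≫ tr ≫ b` instead of `b`. To correct it, `W` adjoins to
  -- `N` a point of `A` over the transported point of `E`; `C'` is its restriction to reflexivity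
  -- paths, so `ρW` is a pullback of the good map `ρ`.
  obtain ⟨C', cE, cC, -, hC'⟩ := Fib.exists_isPullback hD b (Fib.of_mem d hd)
  obtain ⟨W, wN, wC, hw, hW⟩ := Fib.exists_isPullback hD (tr ≫ b) (Fib.of_mem d hd)
  let ρW : C' ⟶ W := hW.lift (cE ≫ ρ) cC (by rw [Category.assoc, reassoc_of% htr, hC'.w])
  have hρWN : ρW ≫ wN = cE ≫ ρ := hW.lift_fst _ _ _
  have hρWC : ρW ≫ wC = cC := hW.lift_snd _ _ _
  have hρW : IsPullback cE ρW ρ wN := by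
    have h1 : IsPullback (ρW ≫ wC) cE d (ρ ≫ tr ≫ b) := by
      rw [hρWC, reassoc_of% htr]
      exact hC'.flip
    exact (IsPullback.of_right h1 hρWN hW.flip).flip
  have ld := gρ _ _ _ hw hρW d hd
  -- The lift is forward transport in `A`: it moves a point over `tr ≫ b` to one over `nE ≫ b`, and
  -- fixes points over reflexivity paths.
  have sqT : CommSq cC ρW d (wN ≫ nE ≫ b) := ⟨by
    rw [reassoc_of% hρWN, reassoc_of% hρE, hC'.w]⟩
  let m : E ⟶ W := hW.lift H' (k' ≫ a) (by
    rw [Category.assoc, sq.w, reassoc_of% hk'g])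
  have hgm : g ≫ m = hC'.lift g a sq.w.symm ≫ ρW := hW.hom_ext
    (by
      rw [Category.assoc, Category.assoc, hρWN, hC'.lift_fst_assoc, hW.lift_fst, hgH])
    (by
      rw [Category.assoc, Category.assoc, hρWC, hC'.lift_snd, hW.lift_snd, reassoc_of% hgk'])
  refine ⟨⟨⟨m ≫ sqT.lift, ?_, ?_⟩⟩⟩
  · rw [reassoc_of% hgm, sqT.fac_left, hC'.lift_snd]
  · rw [Category.assoc, sqT.fac_right, hW.lift_fst_assoc, reassoc_of% hHE]

end GoodPath

/-- The homotopy relation does not depend on the path object. -/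
theorem homotopic_of_homotopic {A : MorphismProperty C} {Y : C} (P Q : PathObject A A.rlp Y)
    {X : C} {f g : X ⟶ Y} (h : P.Homotopic f g) : Q.Homotopic f g := by
  obtain ⟨a, ha₁, ha₂⟩ := h
  obtain ⟨l, hl₁, hl₂⟩ := BinaryFan.IsLimit.lift' Q.isProduct (P.p ≫ P.π₁) (P.p ≫ P.π₂)
  have hl₁ : l ≫ Q.π₁ = _ := hl₁
  have hl₂ : l ≫ Q.π₂ = _ := hl₂
  -- The lift of `P.i` against `Q.p` is a comparison of path objects over `Y × Y`.
  have sq : CommSq Q.i P.i Q.p l := ⟨BinaryFan.IsLimit.hom_ext Q.isProduct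
    (by
      change (Q.i ≫ Q.p) ≫ Q.π₁ = (P.i ≫ l) ≫ Q.π₁
      rw [Category.assoc, Category.assoc, hl₁, P.fac₁, Q.fac₁])
    (by
      change (Q.i ≫ Q.p) ≫ Q.π₂ = (P.i ≫ l) ≫ Q.π₂
      rw [Category.assoc, Category.assoc, hl₂, P.fac₂, Q.fac₂])⟩
  have := Q.mem_p P.i P.mem_i
  refine ⟨a ≫ sq.lift, ?_, ?_⟩
  · rw [Category.assoc, sq.fac_right_assoc, hl₁, ha₁]
  · rw [Category.assoc, sq.fac_right_assoc, hl₂, ha₂]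

/-- Over the diagonal of `V`, the square of `d : A ⟶ V` restricts to the fibre product of `A` with
itself. -/
theorem isPullback_diagonal {V A VV AA N : C} {π₁ π₂ : VV ⟶ V} {σ₁ σ₂ : AA ⟶ A}
    (hV : IsLimit (BinaryFan.mk π₁ π₂)) (hA : IsLimit (BinaryFan.mk σ₁ σ₂)) {d : A ⟶ V}
    {n₁ n₂ : N ⟶ A} (hN : IsPullback n₁ n₂ d d) {dd : AA ⟶ VV} (hd₁ : dd ≫ π₁ = σ₁ ≫ d)
    (hd₂ : dd ≫ π₂ = σ₂ ≫ d) {δ : V ⟶ VV} (hδ₁ : δ ≫ π₁ = 𝟙 V) (hδ₂ : δ ≫ π₂ = 𝟙 V)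
    {n : N ⟶ AA} (hn₁ : n ≫ σ₁ = n₁) (hn₂ : n ≫ σ₂ = n₂) :
    IsPullback (n₁ ≫ d) n δ dd := by
  have exV : ∀ {W : C} {a b : W ⟶ VV}, a ≫ π₁ = b ≫ π₁ → a ≫ π₂ = b ≫ π₂ → a = b :=
    fun h₁ h₂ => BinaryFan.IsLimit.hom_ext hV h₁ h₂
  have exA : ∀ {W : C} {a b : W ⟶ AA}, a ≫ σ₁ = b ≫ σ₁ → a ≫ σ₂ = b ≫ σ₂ → a = b :=
    fun h₁ h₂ => BinaryFan.IsLimit.hom_ext hA h₁ h₂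
  refine IsPullback.mk' (exV ?_ ?_) (fun {W} l l' _ h => ?_) (fun {W} a b hab => ?_)
  · simp [hδ₁, hd₁, reassoc_of% hn₁]
  · simp [hδ₂, hd₂, reassoc_of% hn₂, hN.w]
  · refine hN.hom_ext ?_ ?_
    · rw [← hn₁, reassoc_of% h]
    · rw [← hn₂, reassoc_of% h]
  · have h1 : a = b ≫ σ₁ ≫ d := by
      rw [← hd₁, ← reassoc_of% hab, hδ₁, Category.comp_id]
    have h2 : a = b ≫ σ₂ ≫ d := by
      rw [← hd₂, ← reassoc_of% hab, hδ₂, Category.comp_id]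
    refine ⟨hN.lift (b ≫ σ₁) (b ≫ σ₂) (by simp [← h1, ← h2]), ?_, exA ?_ ?_⟩
    · rw [hN.lift_fst_assoc, h1, Category.assoc]
    · rw [Category.assoc, hn₁, hN.lift_fst]
    · rw [Category.assoc, hn₂, hN.lift_snd]

end DisplayClass

/-! ### Calculus of substitutions -/

namespace TypeTheory

variable {S : Signature.{u}}

@[simp]
theorem sappend_addNat {m n k : ℕ} (σ : Fin m → Expr S n) (a : Fin k → Expr S n) (i : Fin m) :
    sappend σ a (i.addNat k) = σ i := by
  induction k with
  | zero => rfl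
  | succ k ih => exact ih (fun i => a i.succ)

@[simp]
theorem sappend_castLE {m n k : ℕ} (σ : Fin m → Expr S n) (a : Fin k → Expr S n) (i : Fin k)
    (h : k ≤ m + k) : sappend σ a (i.castLE h) = a i := by
  induction k with
  | zero => exact i.elim0
  | succ k ih =>
    refine Fin.cases rfl (fun i => ?_) i
    exact ih (fun i => a i.succ) i (Nat.le_add_left k m)

/-- In a concatenated context the indices of the last `k` variables are unchanged and the earlier
ones are shifted by `k`. -/
theorem forall_fin_add {m k : ℕ} {P : Fin (m + k) → Prop} (h₁ : ∀ i : Fin m, P (i.addNat k))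
    (h₂ : ∀ i : Fin k, P (i.castLE (Nat.le_add_left k m))) (i : Fin (m + k)) : P i := by
  induction k with
  | zero => exact h₁ i
  | succ k ih =>
    refine Fin.cases (h₂ 0) (fun i => ?_) i
    exact ih (P := fun i => P i.succ) h₁ (fun i => h₂ i.succ) i

theorem eq_sappend {m n k : ℕ} (σ : Fin (m + k) → Expr S n) :
    sappend (fun i => σ (i.addNat k)) (fun i => σ (i.castLE (Nat.le_add_left k m))) = σ := by
  funext i
  exact forall_fin_add (P := fun i => _ = σ i) (by simp) (by simp) i

theorem sappend_subst {m n l k : ℕ} (σ : Fin m → Expr S n) (a : Fin k → Expr S n)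
    (τ : Fin n → Expr S l) (i : Fin (m + k)) :
    (sappend σ a i).subst τ = sappend (fun i => (σ i).subst τ) (fun i => (a i).subst τ) i := by
  refine forall_fin_add (P := fun i => (sappend σ a i).subst τ = sappend _ _ i)
    (fun i => ?_) (fun i => ?_) i <;> simp

theorem Expr.wk_subst {m n : ℕ} (e : Expr S m) (σ : Fin (m + 1) → Expr S n) :
    e.wk.subst σ = e.subst (fun i => σ i.succ) :=
  Expr.subst_ren e _ _

theorem liftSub_subst_sappend {l m n k : ℕ} (σ : Fin l → Expr S m) (τ : Fin m → Expr S n)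
    (a : Fin k → Expr S n) (i : Fin (l + k)) :
    (liftSub σ k i).subst (sappend τ a) = sappend (fun i => (σ i).subst τ) a i := by
  induction k with
  | zero => rfl
  | succ k ih =>
    refine Fin.cases rfl (fun i => ?_) i
    exact (Expr.wk_subst _ _).trans (ih (fun i => a i.succ) i)

theorem Expr.subst_liftSub_sappend {l m n k : ℕ} (e : Expr S (l + k)) (σ : Fin l → Expr S m)
    (τ : Fin m → Expr S n) (a : Fin k → Expr S n) :
    (e.subst (liftSub σ k)).subst (sappend τ a)
      = e.subst (sappend (fun i => (σ i).subst τ) a) := by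
  rw [Expr.subst_subst]
  exact congrArg _ (funext fun i => liftSub_subst_sappend σ τ a i)

theorem Expr.subst_liftSub_subst {l m n k : ℕ} (e : Expr S (l + k)) (σ : Fin l → Expr S m)
    (τ : Fin m → Expr S n) :
    (e.subst (liftSub σ k)).subst (liftSub τ k)
      = e.subst (liftSub (fun i => (σ i).subst τ) k) := by
  rw [Expr.subst_subst]
  exact congrArg _ (liftSub_comp σ τ k)

theorem Tele.subst_subst {l m n k : ℕ} (Φ : Tele S l k) (σ : Fin l → Expr S m)
    (τ : Fin m → Expr S n) :
    (Φ.subst σ).subst τ = Φ.subst (fun i => (σ i).subst τ) := by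
  induction Φ with
  | nil => rfl
  | snoc Φ A ih =>
    simp only [Tele.subst, ih, Expr.subst_liftSub_subst]

theorem Tele.subst_var {n k : ℕ} (Φ : Tele S n k) : Φ.subst Expr.var = Φ := by
  induction Φ with
  | nil => rfl
  | snoc Φ A ih => simp only [Tele.subst, ih, liftSub_var, Expr.subst_var]

end TypeTheory

namespace DependentTypeTheory

variable {S : Signature.{u}} {T : DependentTypeTheory S}

/-! ### Context morphisms into extended contexts -/

theorem mor_snoc {m n : ℕ} {Ξ : Ctx S m} {Γ : Ctx S n} {A : Expr S n}
    {σ : Fin (n + 1) → Expr S m} :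
    T.Mor Ξ (Γ.snoc A) σ ↔ T.Mor Ξ Γ (fun i => σ i.succ) ∧
      T.Derivable Ξ (.isElem (σ 0) (A.subst (fun i => σ i.succ))) := by
  constructor
  · intro h
    refine ⟨fun i => ?_, ?_⟩
    · rw [← Expr.wk_subst]
      exact h i.succ
    · rw [← Expr.wk_subst]
      exact h 0
  · rintro ⟨h₁, h₂⟩ i
    refine Fin.cases ?_ (fun i => ?_) i
    · rw [← Expr.wk_subst] at h₂
      exact h₂
    · have := h₁ i
      rw [← Expr.wk_subst] at this
      exact this

theorem morphismEq_snoc {m n : ℕ} {Ξ : Ctx S m} {Γ : Ctx S n} {A : Expr S n}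
    {σ τ : Fin (n + 1) → Expr S m} :
    T.MorphismEq Ξ (Γ.snoc A) σ τ ↔ T.MorphismEq Ξ Γ (fun i => σ i.succ) (fun i => τ i.succ) ∧
      T.Derivable Ξ (.eqElem (σ 0) (τ 0) (A.subst (fun i => σ i.succ))) := by
  constructor
  · intro h
    refine ⟨fun i => ?_, ?_⟩
    · rw [← Expr.wk_subst]
      exact h i.succ
    · rw [← Expr.wk_subst]
      exact h 0
  · rintro ⟨h₁, h₂⟩ i
    refine Fin.cases ?_ (fun i => ?_) i
    · rw [← Expr.wk_subst] at h₂
      exact h₂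
    · have := h₁ i
      rw [← Expr.wk_subst] at this
      exact this

theorem Mor.scons {m n : ℕ} {Ξ : Ctx S m} {Γ : Ctx S n} {A : Expr S n} {σ : Fin n → Expr S m}
    {a : Expr S m} (hσ : T.Mor Ξ Γ σ) (ha : T.Derivable Ξ (.isElem a (A.subst σ))) :
    T.Mor Ξ (Γ.snoc A) (scons a σ) :=
  mor_snoc.2 ⟨hσ, ha⟩

theorem mor_append {m n k : ℕ} {Ξ : Ctx S m} {Γ : Ctx S n} {Φ : Tele S n k}
    {σ : Fin n → Expr S m} {a : Fin k → Expr S m} :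
    T.Mor Ξ (Γ.append Φ) (sappend σ a) ↔ T.Mor Ξ Γ σ ∧ T.IsDepElem Ξ (Φ.subst σ) a := by
  induction Φ with
  | nil => exact (iff_of_eq (and_true _)).symm
  | snoc Φ A ih =>
    refine mor_snoc.trans ((and_congr_left' (ih (a := fun i => a i.succ))).trans ?_)
    simp only [IsDepElem, Tele.subst, Expr.subst_liftSub_sappend, Expr.subst_var, and_assoc]
    rfl

theorem Mor.append_iff {m n k : ℕ} {Ξ : Ctx S m} {Γ : Ctx S n} {Φ : Tele S n k}
    {σ : Fin (n + k) → Expr S m} :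
    T.Mor Ξ (Γ.append Φ) σ ↔ T.Mor Ξ Γ (fun i => σ (i.addNat k)) ∧
      T.IsDepElem Ξ (Φ.subst (fun i => σ (i.addNat k)))
        (fun i => σ (i.castLE (Nat.le_add_left k n))) := by
  conv_lhs => rw [← eq_sappend σ]
  exact mor_append

theorem Wf.snoc {n : ℕ} {Γ : Ctx S n} {A : Expr S n} (h : T.Derivable Γ (.isType A)) :
    T.Wf (Γ.snoc A) :=
  ⟨T.wf_of_derivable h, h⟩

theorem isType_subst {m n : ℕ} {Ξ : Ctx S m} {Γ : Ctx S n} {σ : Fin n → Expr S m} {A : Expr S n}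
    (hΞ : T.Wf Ξ) (hσ : T.Mor Ξ Γ σ) (h : T.Derivable Γ (.isType A)) :
    T.Derivable Ξ (.isType (A.subst σ)) :=
  T.subst hΞ hσ h

theorem isElem_subst {m n : ℕ} {Ξ : Ctx S m} {Γ : Ctx S n} {σ : Fin n → Expr S m}
    {a A : Expr S n} (hΞ : T.Wf Ξ) (hσ : T.Mor Ξ Γ σ) (h : T.Derivable Γ (.isElem a A)) :
    T.Derivable Ξ (.isElem (a.subst σ) (A.subst σ)) :=
  T.subst hΞ hσ h

theorem eqType_subst {m n : ℕ} {Ξ : Ctx S m} {Γ : Ctx S n} {σ : Fin n → Expr S m}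
    {A B : Expr S n} (hΞ : T.Wf Ξ) (hσ : T.Mor Ξ Γ σ) (h : T.Derivable Γ (.eqType A B)) :
    T.Derivable Ξ (.eqType (A.subst σ) (B.subst σ)) :=
  T.subst hΞ hσ h

theorem eqElem_subst {m n : ℕ} {Ξ : Ctx S m} {Γ : Ctx S n} {σ : Fin n → Expr S m}
    {a b A : Expr S n} (hΞ : T.Wf Ξ) (hσ : T.Mor Ξ Γ σ) (h : T.Derivable Γ (.eqElem a b A)) :
    T.Derivable Ξ (.eqElem (a.subst σ) (b.subst σ) (A.subst σ)) :=
  T.subst hΞ hσ h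

theorem isElem_wk {n : ℕ} {Γ : Ctx S n} {B a A : Expr S n} (hB : T.Derivable Γ (.isType B))
    (h : T.Derivable Γ (.isElem a A)) : T.Derivable (Γ.snoc B) (.isElem a.wk A.wk) := by
  rw [Expr.wk_eq_subst, Expr.wk_eq_subst]
  exact isElem_subst (Wf.snoc hB) (Mor.wk (Wf.snoc hB)) h

theorem isType_wk {n : ℕ} {Γ : Ctx S n} {B A : Expr S n} (hB : T.Derivable Γ (.isType B))
    (h : T.Derivable Γ (.isType A)) : T.Derivable (Γ.snoc B) (.isType A.wk) := by
  rw [Expr.wk_eq_subst]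
  exact isType_subst (Wf.snoc hB) (Mor.wk (Wf.snoc hB)) h

theorem isElem_var_zero {n : ℕ} {Γ : Ctx S n} {A : Expr S n} (hA : T.Derivable Γ (.isType A)) :
    T.Derivable (Γ.snoc A) (.isElem (.var 0) A.wk) :=
  T.var (Wf.snoc hA) 0

/-- The two claims need each other: the next type of the telescope is substituted along the lifted
morphism, which must already be known to have a well-formed domain. -/
theorem Wf.append_subst_and_mor {m n k : ℕ} {Ξ : Ctx S m} {Γ : Ctx S n} {Φ : Tele S n k}
    {σ : Fin n → Expr S m} (hΞ : T.Wf Ξ) (hσ : T.Mor Ξ Γ σ) (h : T.Wf (Γ.append Φ)) :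
    T.Wf (Ξ.append (Φ.subst σ)) ∧
      T.Mor (Ξ.append (Φ.subst σ)) (Γ.append Φ) (liftSub σ k) := by
  induction Φ with
  | nil => exact ⟨hΞ, hσ⟩
  | snoc Φ A ih =>
    obtain ⟨h₁, h₂⟩ := ih h.1
    have h₃ := isType_subst h₁ h₂ h.2
    refine ⟨⟨h₁, h₃⟩, mor_snoc.2 ⟨?_, ?_⟩⟩
    · have := Mor.comp (Wf.snoc h₃) (Mor.wk (Wf.snoc h₃)) h₂
      simp only [← Expr.wk_eq_subst] at this
      exact this
    · have := isElem_var_zero h₃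
      rw [Expr.wk_eq_subst, Expr.subst_subst] at this
      simp only [← Expr.wk_eq_subst] at this
      exact this

theorem Wf.append_subst {m n k : ℕ} {Ξ : Ctx S m} {Γ : Ctx S n} {Φ : Tele S n k}
    {σ : Fin n → Expr S m} (hΞ : T.Wf Ξ) (hσ : T.Mor Ξ Γ σ) (h : T.Wf (Γ.append Φ)) :
    T.Wf (Ξ.append (Φ.subst σ)) :=
  (Wf.append_subst_and_mor hΞ hσ h).1

theorem Mor.liftSub {m n k : ℕ} {Ξ : Ctx S m} {Γ : Ctx S n} {Φ : Tele S n k}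
    {σ : Fin n → Expr S m} (hΞ : T.Wf Ξ) (hσ : T.Mor Ξ Γ σ) (h : T.Wf (Γ.append Φ)) :
    T.Mor (Ξ.append (Φ.subst σ)) (Γ.append Φ) (liftSub σ k) :=
  (Wf.append_subst_and_mor hΞ hσ h).2

/-! ### Maps of the classifying category -/

theorem exists_eq_ob (X : ClassifyingCat T) :
    ∃ (n : ℕ) (Γ : Ctx S n) (h : T.Wf Γ), X = ob Γ h := by
  obtain ⟨n, ⟨Γ, h⟩⟩ := X
  exact ⟨n, Γ, h, rfl⟩

section

variable {l m n : ℕ} {Γ : Ctx S n} {Δ : Ctx S m} {Ξ : Ctx S l} {hΓ : T.Wf Γ} {hΔ : T.Wf Δ}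
  {hΞ : T.Wf Ξ}

theorem exists_eq_hom (f : ob Γ hΓ ⟶ ob Δ hΔ) : ∃ σ hσ, f = hom hΓ hΔ σ hσ := by
  obtain ⟨σ, hσ⟩ := f
  exact ⟨σ, hσ, rfl⟩

theorem hom_eq_iff {σ τ : Fin m → Expr S n} {hσ : T.Mor Γ Δ σ} {hτ : T.Mor Γ Δ τ} :
    hom hΓ hΔ σ hσ = hom hΓ hΔ τ hτ ↔ T.MorphismEq Γ Δ σ τ :=
  ⟨fun h => (Quotient.exact (s := homSetoid (ob Γ hΓ) (ob Δ hΔ)) h).2.2,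
    fun h => Quotient.sound (s := homSetoid (ob Γ hΓ) (ob Δ hΔ)) ⟨hσ, hτ, h⟩⟩

theorem hom_comp {σ : Fin m → Expr S n} {τ : Fin l → Expr S m} (hσ : T.Mor Γ Δ σ)
    (hτ : T.Mor Δ Ξ τ) :
    hom hΓ hΔ σ hσ ≫ hom hΔ hΞ τ hτ
      = hom hΓ hΞ (fun i => (τ i).subst σ) (Mor.comp hΓ hσ hτ) :=
  rfl

theorem hom_congr {σ τ : Fin m → Expr S n} (hσ : T.Mor Γ Δ σ) (hτ : T.Mor Γ Δ τ) (h : σ = τ) :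
    hom hΓ hΔ σ hσ = hom hΓ hΔ τ hτ := by
  subst h
  rfl

theorem hom_var : hom hΓ hΓ Expr.var (Mor.id hΓ) = 𝟙 (ob Γ hΓ) :=
  rfl

end

/-- The display map `(Γ, x ∈ A) ⟶ Γ`. -/
abbrev disp {n : ℕ} {Γ : Ctx S n} {A : Expr S n} (h : T.Wf (Γ.snoc A)) :
    ob (Γ.snoc A) h ⟶ ob Γ h.1 :=
  hom h h.1 (fun i => Expr.var i.succ) (Mor.wk h)

/-- The dependent projection `(Γ, Φ) ⟶ Γ`. -/
abbrev proj {n k : ℕ} {Γ : Ctx S n} (hΓ : T.Wf Γ) {Φ : Tele S n k} (h : T.Wf (Γ.append Φ)) :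
    ob (Γ.append Φ) h ⟶ ob Γ hΓ :=
  hom h hΓ (fun i => Expr.var (i.addNat k)) (Mor.wkAppend Φ h).2

theorem displayMaps_disp {n : ℕ} {Γ : Ctx S n} {A : Expr S n} (h : T.Wf (Γ.snoc A)) :
    T.displayMaps (disp h) :=
  IsDisplayMap.mk Γ A h

theorem Mor.lift_one {m n : ℕ} {Δ : Ctx S m} {Γ : Ctx S n} {σ : Fin n → Expr S m} {A : Expr S n}
    {B : Expr S m} (hσ : T.Mor Δ Γ σ) (hB : T.Derivable Δ (.eqType B (A.subst σ))) :
    T.Mor (Δ.snoc B) (Γ.snoc A) (TypeTheory.liftSub σ 1) := by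
  have hw := Wf.snoc (T.isType_left hB)
  refine mor_snoc.2 ⟨?_, ?_⟩
  · have := Mor.comp hw (Mor.wk hw) hσ
    simp only [← Expr.wk_eq_subst] at this
    exact this
  · have h₁ := eqType_subst hw (Mor.wk hw) hB
    rw [Expr.subst_subst] at h₁
    simp only [← Expr.wk_eq_subst] at h₁
    exact T.isElem_conv (isElem_var_zero (T.isType_left hB)) h₁

open DisplayClass

/-- Substitution in a type is pullback of its display map. The type `B` need only be definitionally
equal to the substituted one, because identity types commute with substitution only up to
definitional equality. -/
theorem isPullback_disp {m n : ℕ} {Δ : Ctx S m} {Γ : Ctx S n} {σ : Fin n → Expr S m}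
    {A : Expr S n} {B : Expr S m} (hΔ : T.Wf Δ) (hσ : T.Mor Δ Γ σ)
    (hB : T.Derivable Δ (.eqType B (A.subst σ))) (hΔB : T.Wf (Δ.snoc B)) (hA : T.Wf (Γ.snoc A)) :
    IsPullback (disp hΔB) (hom hΔB hA (TypeTheory.liftSub σ 1) (Mor.lift_one hσ hB))
      (hom hΔ hA.1 σ hσ) (disp hA) := by
  refine IsPullback.mk' ?_ ?_ ?_
  · rw [hom_comp, hom_comp]
    refine hom_congr _ _ (funext fun i => ?_)
    exact (Expr.wk_eq_subst _).symm
  · intro X φ φ' h₁ h₂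
    obtain ⟨l, Ξ, hΞ, rfl⟩ := exists_eq_ob X
    obtain ⟨α, hα, rfl⟩ := exists_eq_hom φ
    obtain ⟨β, hβ, rfl⟩ := exists_eq_hom φ'
    rw [hom_comp, hom_comp, hom_eq_iff] at h₁ h₂
    refine hom_eq_iff.2 (morphismEq_snoc.2 ⟨h₁, ?_⟩)
    refine T.eqElem_conv (h₂ 0) ?_
    have := eqType_subst hΞ (mor_snoc.1 hα).1 hB
    rw [Expr.subst_subst] at this
    refine T.eqType_symm ?_
    convert this using 2
    change A.wk.subst _ = _
    rw [Expr.wk_subst]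
    exact congrArg _ (funext fun i => Expr.wk_subst _ _)
  · intro X a b h
    obtain ⟨l, Ξ, hΞ, rfl⟩ := exists_eq_ob X
    obtain ⟨α, hα, rfl⟩ := exists_eq_hom a
    obtain ⟨β, hβ, rfl⟩ := exists_eq_hom b
    rw [hom_comp, hom_comp, hom_eq_iff] at h
    obtain ⟨hβ₁, hβ₂⟩ := mor_snoc.1 hβ
    have e₁ := eqType_subst hΞ hα hB
    rw [Expr.subst_subst] at e₁
    have e₂ := T.subst_eqType hΞ (Mor.comp hΞ hα hσ) hβ₁ h hA.2
    have hl : T.Mor Ξ (Δ.snoc B) (scons (β 0) α) :=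
      Mor.scons hα (T.isElem_conv hβ₂ (T.eqType_symm (T.eqType_trans e₁ e₂)))
    have hc : (fun i => ((TypeTheory.liftSub σ 1) (Fin.succ i)).subst (scons (β 0) α))
        = fun i => (σ i).subst α := funext fun i => Expr.wk_subst _ _
    refine ⟨hom hΞ hΔB _ hl, ?_, ?_⟩
    · rw [hom_comp]
      rfl
    · rw [hom_comp, hom_eq_iff, morphismEq_snoc, hc]
      exact ⟨h, T.eqElem_refl (T.isElem_conv hβ₂ (T.eqType_symm e₂))⟩

theorem exists_isPullback_disp {Y Z : ClassifyingCat T} {d : Y ⟶ Z} (hd : T.displayMaps d) {n : ℕ}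
    {Δ : Ctx S n} {hΔ : T.Wf Δ} (f : ob Δ hΔ ⟶ Z) :
    ∃ (A : Expr S n) (h : T.Wf (Δ.snoc A)) (g : _), IsPullback (disp h) g f d := by
  obtain ⟨Γ, A, h⟩ := hd
  obtain ⟨σ, hσ, rfl⟩ := exists_eq_hom f
  have h₁ := isType_subst hΔ hσ h.2
  exact ⟨A.subst σ, Wf.snoc h₁, _, isPullback_disp hΔ hσ (T.eqType_refl h₁) _ h⟩

theorem hasBaseChange : HasBaseChange T.displayMaps := by
  intro X Y Z f d hd
  obtain ⟨n, Δ, hΔ, rfl⟩ := exists_eq_ob X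
  obtain ⟨A, h, g, hg⟩ := exists_isPullback_disp hd f
  exact ⟨_, _, g, displayMaps_disp h, hg⟩

theorem fib_proj {n k : ℕ} {Γ : Ctx S n} (hΓ : T.Wf Γ) {Φ : Tele S n k} (h : T.Wf (Γ.append Φ)) :
    Fib T.displayMaps (proj hΓ h) := by
  induction Φ with
  | nil => exact Fib.id _
  | snoc Φ A ih => exact Fib.comp _ _ (displayMaps_disp h) (ih h.1)

theorem IsDependentProjection.fib {X Y : ClassifyingCat T} {p : X ⟶ Y}
    (hp : T.IsDependentProjection p) : Fib T.displayMaps p := by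
  obtain ⟨Γ, Φ, h⟩ := hp
  exact fib_proj _ h

theorem isPullback_proj {m n k : ℕ} {Δ : Ctx S m} {Γ : Ctx S n} {σ : Fin n → Expr S m}
    {Φ : Tele S n k} (hΔ : T.Wf Δ) (hΓ : T.Wf Γ) (hσ : T.Mor Δ Γ σ)
    (hΔΦ : T.Wf (Δ.append (Φ.subst σ))) (hΦ : T.Wf (Γ.append Φ)) :
    IsPullback (proj hΔ hΔΦ) (hom hΔΦ hΦ (TypeTheory.liftSub σ k) (Mor.liftSub hΔ hσ hΦ))
      (hom hΔ hΓ σ hσ) (proj hΓ hΦ) := by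
  induction Φ with
  | nil => exact IsPullback.of_id_fst
  | snoc Φ A ih =>
    have h₁ := ih hΔΦ.1 hΦ.1
    have h₂ := isPullback_disp hΔΦ.1 (Mor.liftSub hΔ hσ hΦ.1) (T.eqType_refl hΔΦ.2) hΔΦ hΦ
    exact h₂.paste_horiz h₁

/-- The display maps composing a fibration pull back one at a time, and each adds one declaration to
a telescope over `Δ`. -/
theorem exists_isPullback_proj {Y Z : ClassifyingCat T} {p : Y ⟶ Z} (hp : Fib T.displayMaps p)
    {n : ℕ} {Δ : Ctx S n} {hΔ : T.Wf Δ} (f : ob Δ hΔ ⟶ Z) :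
    ∃ (k : ℕ) (Φ : Tele S n k) (h : T.Wf (Δ.append Φ)) (g : _),
      IsPullback (proj hΔ h) g f p := by
  induction hp with
  | id => exact ⟨0, Tele.nil, hΔ, f, IsPullback.of_id_fst⟩
  | iso_comp e p he _ ih =>
    obtain ⟨k, Φ, h, g, hg⟩ := ih f
    refine ⟨k, Φ, h, g ≫ inv e, ?_⟩
    simpa using (IsPullback.of_horiz_isIso (fst := 𝟙 _) (snd := g ≫ inv e) (f := g) (g := e)
      ⟨by simp⟩).paste_horiz hg
  | comp d p hd _ ih =>
    obtain ⟨k, Φ, h, g, hg⟩ := ih f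
    obtain ⟨A, h', g', hg'⟩ := exists_isPullback_disp hd g
    exact ⟨k + 1, Φ.snoc A, h', g', hg'.paste_horiz hg⟩

/-- The empty context is terminal. -/
def isTerminalNil : IsTerminal (ob (T := T) Ctx.nil trivial) := by
  refine IsTerminal.ofUniqueHom
    (fun X => Quotient.mk (homSetoid X (ob Ctx.nil trivial)) ⟨fun i => i.elim0, ?_⟩) ?_
  · obtain ⟨n, ⟨Γ⟩⟩ := X
    exact fun i => i.elim0
  · intro X f
    obtain ⟨n, Γ, hΓ, rfl⟩ := exists_eq_ob X
    obtain ⟨σ, hσ, rfl⟩ := exists_eq_hom f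
    exact hom_eq_iff.2 fun i => i.elim0

theorem fib_to_nil {X : ClassifyingCat T} (f : X ⟶ ob (T := T) Ctx.nil trivial) :
    Fib T.displayMaps f := by
  obtain ⟨n, Γ, hΓ, rfl⟩ := exists_eq_ob X
  induction Γ with
  | nil =>
    rw [isTerminalNil.hom_ext f (𝟙 _)]
    exact Fib.id _
  | snoc Γ A ih =>
    rw [isTerminalNil.hom_ext f (disp hΓ ≫ isTerminalNil.from _)]
    exact Fib.comp _ _ (displayMaps_disp hΓ) (ih hΓ.1 _)

/-- A context morphism is an `𝒜`-map if and only if sections of dependent types extend along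
it. -/
theorem classA_hom_iff {m n : ℕ} {Γ : Ctx S n} {Δ : Ctx S m} {hΓ : T.Wf Γ} {hΔ : T.Wf Δ}
    {σ : Fin m → Expr S n} {hσ : T.Mor Γ Δ σ} :
    T.classA (hom hΓ hΔ σ hσ) ↔ ∀ (B : Expr S m) (d : Expr S n), T.Derivable Δ (.isType B) →
      T.Derivable Γ (.isElem d (B.subst σ)) → ∃ t : Expr S m, T.Derivable Δ (.isElem t B) ∧
        T.Derivable Γ (.eqElem (t.subst σ) d (B.subst σ)) := by
  constructor
  · intro h B d hB hd
    have hw := Wf.snoc hB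
    have := h _ (displayMaps_disp hw)
    have sq : CommSq (hom hΓ hw (scons d σ) (Mor.scons hσ hd)) (hom hΓ hΔ σ hσ) (disp hw)
        (𝟙 _) := ⟨by rw [hom_comp, Category.comp_id]; rfl⟩
    obtain ⟨τ, hτ, e⟩ := exists_eq_hom sq.lift
    have e₁ := sq.fac_left
    have e₂ := sq.fac_right
    rw [e, hom_comp, hom_eq_iff] at e₁
    rw [e, hom_comp, ← hom_var, hom_eq_iff] at e₂
    obtain ⟨hτ₁, hτ₂⟩ := mor_snoc.1 hτ
    -- The lift is a section of the display map only up to definitional equality, so its last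
    -- component must be converted to the type `B`.
    have hc := T.subst_eqType hΔ hτ₁ (Mor.id hΔ) e₂ hB
    have hc' := eqType_subst hΓ hσ hc
    rw [Expr.subst_var] at hc hc'
    rw [Expr.subst_subst] at hc'
    exact ⟨τ 0, T.isElem_conv hτ₂ hc, T.eqElem_conv (morphismEq_snoc.1 e₁).2 hc'⟩
  · intro h X Y d hd
    obtain ⟨Ξ, B, hB⟩ := hd
    refine ⟨fun {a b} sq => ?_⟩
    obtain ⟨ω, hω, rfl⟩ := exists_eq_hom a
    obtain ⟨υ, hυ, rfl⟩ := exists_eq_hom b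
    have e := sq.w
    rw [hom_comp, hom_comp, hom_eq_iff] at e
    obtain ⟨hω₁, hω₂⟩ := mor_snoc.1 hω
    have hc := T.subst_eqType hΓ hω₁ (Mor.comp hΓ hσ hυ) e hB.2
    have hd := T.isElem_conv hω₂ hc
    rw [← Expr.subst_subst] at hd
    obtain ⟨t, ht₁, ht₂⟩ := h (B.subst υ) (ω 0) (isType_subst hΔ hυ hB.2) hd
    refine ⟨⟨⟨hom hΔ hB (scons t υ) (Mor.scons hυ ht₁), ?_, ?_⟩⟩⟩
    · rw [hom_comp, hom_eq_iff, morphismEq_snoc]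
      refine ⟨MorphismEq.symm hΓ hB.1 hω₁ (Mor.comp hΓ hσ hυ) e, ?_⟩
      rw [Expr.subst_subst] at ht₂
      exact ht₂
    · rw [hom_comp]
      rfl

end DependentTypeTheory

namespace DependentTypeTheory

variable {S : Signature.{u}} {T : DependentTypeTheory S}

open DisplayClass

/-! ### Reflexivity maps -/

/-- The contexts and the lifted morphisms are compared simultaneously: the lift of `τ` is defined on
the second context, and is a morphism out of the first one only by the equality of contexts already
obtained. -/
theorem append_congr {m n k : ℕ} {Δ : Ctx S m} {Γ : Ctx S n} {σ τ : Fin n → Expr S m}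
    {Φ : Tele S n k} (hΔ : T.Wf Δ) (hσ : T.Mor Δ Γ σ) (hτ : T.Mor Δ Γ τ)
    (e : T.MorphismEq Δ Γ σ τ) (h : T.Wf (Γ.append Φ)) :
    T.CtxEq (Δ.append (Φ.subst σ)) (Δ.append (Φ.subst τ)) ∧
      T.MorphismEq (Δ.append (Φ.subst σ)) (Γ.append Φ) (liftSub σ k) (liftSub τ k) := by
  induction Φ with
  | nil => exact ⟨CtxEq.refl hΔ, e⟩
  | snoc Φ A ih =>
    obtain ⟨c, e'⟩ := ih h.1
    have hw := Wf.append_subst hΔ hσ h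
    have hw' := Wf.append_subst hΔ hτ h
    have hσ' := Mor.liftSub hΔ hσ h.1
    have hτ' := CtxEq.mor_congr hw'.1 hw.1 h.1 h.1 (CtxEq.symm hw.1 hw'.1 c)
      (CtxEq.refl h.1) (Mor.liftSub hΔ hτ h.1)
    refine ⟨⟨c, T.subst_eqType hw.1 hσ' hτ' e' h.2⟩, morphismEq_snoc.2 ⟨?_, ?_⟩⟩
    · have := MorphismEq.comp hw (Mor.wk hw) (Mor.wk hw) hσ' (MorphismEq.refl (Mor.wk hw)) e'
      simp only [← Expr.wk_eq_subst] at this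
      exact this
    · exact T.eqElem_refl (mor_snoc.1 (Mor.liftSub hΔ hσ h)).2

/-- To be good it suffices to have the lifting property after pullback along dependent
projections. -/
theorem good_hom_of_liftSub {m n : ℕ} {Δ : Ctx S m} {Γ : Ctx S n} {σ : Fin n → Expr S m}
    {hΔ : T.Wf Δ} {hΓ : T.Wf Γ} {hσ : T.Mor Δ Γ σ}
    (h : ∀ {k : ℕ} (Θ : Tele S n k) (hΘ : T.Wf (Γ.append Θ)),
      T.classA (hom (Wf.append_subst hΔ hσ hΘ) hΘ (liftSub σ k) (Mor.liftSub hΔ hσ hΘ))) :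
    Good T.displayMaps (hom hΔ hΓ σ hσ) := by
  intro P Y q g p hp hg
  -- Pulling `p` back along the identity replaces it by an isomorphic dependent projection.
  obtain ⟨k, Θ, hΘ, e, he⟩ := exists_isPullback_proj hp (𝟙 (ob Γ hΓ))
  have := he.isIso_snd_of_isIso
  have h₁ := (isPullback_proj hΔ hΓ hσ (Wf.append_subst hΔ hσ hΘ) hΘ).paste_vert he
  rw [Category.comp_id] at h₁
  have : g = (hg.isoIsPullback _ _ h₁).hom ≫ hom (Wf.append_subst hΔ hσ hΘ) hΘ (liftSub σ k)
      (Mor.liftSub hΔ hσ hΘ) ≫ e := by simp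
  rw [this]
  exact T.displayMaps.llp.comp_mem _ _ (MorphismProperty.llp_of_isIso _ _)
    (T.displayMaps.llp.comp_mem _ _ (h Θ hΘ) (MorphismProperty.llp_of_isIso _ _))

namespace IdentityTypes

variable (E : T.IdentityTypes)

/-- The context `(Γ, x ∈ A, y ∈ A, u ∈ Id(x, y))`. -/
abbrev idCtx {n : ℕ} (Γ : Ctx S n) (A : Expr S n) : Ctx S (n + 3) :=
  ((Γ.snoc A).snoc A.wk).snoc (E.Id A.wk.wk (.var 1) (.var 0))

/-- The context morphism `(x, x, r(x))`. -/
abbrev diagSub {n : ℕ} (A : Expr S n) : Fin (n + 3) → Expr S (n + 1) :=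
  scons (E.refl A.wk (.var 0)) (scons (.var 0) Expr.var)

variable {E}

section

variable {n : ℕ} {Γ : Ctx S n} {A : Expr S n} (hA : T.Derivable Γ (.isType A))

include hA

theorem isType_wk_wk : T.Derivable ((Γ.snoc A).snoc A.wk) (.isType A.wk.wk) :=
  isType_wk (isType_wk hA hA) (isType_wk hA hA)

theorem isElem_var_one : T.Derivable ((Γ.snoc A).snoc A.wk) (.isElem (.var 1) A.wk.wk) :=
  isElem_wk (isType_wk hA hA) (isElem_var_zero hA)

theorem isElem_var_zero' : T.Derivable ((Γ.snoc A).snoc A.wk) (.isElem (.var 0) A.wk.wk) :=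
  isElem_var_zero (isType_wk hA hA)

theorem wf_idCtx : T.Wf (E.idCtx Γ A) :=
  Wf.snoc (E.formation (isType_wk_wk hA) (isElem_var_one hA) (isElem_var_zero' hA))

theorem mor_dup : T.Mor (Γ.snoc A) ((Γ.snoc A).snoc A.wk) (scons (.var 0) Expr.var) :=
  Mor.scons (Mor.id (Wf.snoc hA)) (by
    rw [Expr.subst_var]
    exact isElem_var_zero hA)

theorem mor_diagSub : T.Mor (Γ.snoc A) (E.idCtx Γ A) (E.diagSub A) := by
  refine Mor.scons (mor_dup hA) (T.isElem_conv (E.introduction (isElem_var_zero hA)) ?_)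
  have := E.Id_subst (Wf.snoc hA) (mor_dup hA) (isType_wk_wk hA) (isElem_var_one hA)
    (isElem_var_zero' hA)
  have e : A.wk.wk.subst (scons (.var 0) Expr.var) = A.wk := by
    rw [Expr.wk_subst]
    exact Expr.subst_var _
  rw [e] at this
  exact T.eqType_symm this

theorem mor_liftSub_two {m : ℕ} {Δ : Ctx S m} {σ : Fin n → Expr S m} (hΔ : T.Wf Δ)
    (hσ : T.Mor Δ Γ σ) :
    T.Mor ((Δ.snoc (A.subst σ)).snoc (A.subst σ).wk) ((Γ.snoc A).snoc A.wk) (liftSub σ 2) := by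
  have := Mor.liftSub (Φ := (Tele.nil.snoc A).snoc A.wk) hΔ hσ (Wf.snoc (isType_wk hA hA))
  have e : A.wk.subst (liftSub σ 1) = (A.subst σ).wk := by
    rw [Expr.wk_subst, Expr.wk, Expr.ren_subst]
    rfl
  simp only [Tele.subst, Ctx.append] at this
  rw [e] at this
  exact this

theorem mor_liftSub_three {m : ℕ} {Δ : Ctx S m} {σ : Fin n → Expr S m} (hΔ : T.Wf Δ)
    (hσ : T.Mor Δ Γ σ) : T.Mor (E.idCtx Δ (A.subst σ)) (E.idCtx Γ A) (liftSub σ 3) := by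
  have hA' := isType_subst hΔ hσ hA
  have h₂ := mor_liftSub_two hA hΔ hσ
  refine Mor.lift_one h₂ (T.eqType_symm ?_)
  have := E.Id_subst (Wf.snoc (isType_wk hA' hA')) h₂ (isType_wk_wk hA) (isElem_var_one hA)
    (isElem_var_zero' hA)
  have e : A.wk.wk.subst (liftSub σ 2) = (A.subst σ).wk.wk := by
    rw [Expr.wk_subst, Expr.wk_subst, Expr.wk, Expr.wk, Expr.ren_subst, Expr.ren_subst]
    rfl
  rw [e] at this
  exact this

/-- The premisses of the elimination rule are preserved by substitution. -/
theorem elimination_premisses_subst {m k : ℕ} {Δ : Ctx S m} {σ : Fin n → Expr S m}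
    {Θ : Tele S (n + 3) k} {C : Expr S (n + 3 + k)} {d : Expr S (n + 1 + k)} (hΔ : T.Wf Δ)
    (hσ : T.Mor Δ Γ σ) (hC : T.Derivable ((E.idCtx Γ A).append Θ) (.isType C))
    (hd : T.Derivable ((Γ.snoc A).append (Θ.subst (E.diagSub A)))
      (.isElem d (C.subst (liftSub (E.diagSub A) k)))) :
    T.Derivable ((E.idCtx Δ (A.subst σ)).append (Θ.subst (liftSub σ 3)))
      (.isType (C.subst (liftSub (liftSub σ 3) k))) ∧
    T.Derivable ((Δ.snoc (A.subst σ)).append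
        ((Θ.subst (liftSub σ 3)).subst (E.diagSub (A.subst σ))))
      (.isElem (d.subst (liftSub (liftSub σ 1) k))
        ((C.subst (liftSub (liftSub σ 3) k)).subst (liftSub (E.diagSub (A.subst σ)) k))) := by
  have hA' := isType_subst hΔ hσ hA
  have hΘ := T.wf_of_derivable hC
  have h₃ := mor_liftSub_three (E := E) hA hΔ hσ
  have h₁ : T.Mor (Δ.snoc (A.subst σ)) (Γ.snoc A) (liftSub σ 1) :=
    Mor.lift_one hσ (T.eqType_refl hA')
  refine ⟨isType_subst (Wf.append_subst (wf_idCtx hA') h₃ hΘ)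
    (Mor.liftSub (wf_idCtx hA') h₃ hΘ) hC, ?_⟩
  have hw := Wf.snoc hA'
  have hα := Mor.comp hw h₁ (mor_diagSub (E := E) hA)
  have hβ := Mor.comp hw (mor_diagSub (E := E) hA') h₃
  -- Naturality of `(x, x, r(x))` is strict in all components but the last, where `refl_subst`
  -- supplies only a definitional equality. Therefore the telescope, the type and `d` have to be
  -- converted afterwards.
  have e : T.MorphismEq (Δ.snoc (A.subst σ)) (E.idCtx Γ A)
      (fun i => (E.diagSub A i).subst (liftSub σ 1))
      (fun i => (liftSub σ 3 i).subst (E.diagSub (A.subst σ))) := by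
    have e₀ : (fun i : Fin (n + 2) => (E.diagSub A i.succ).subst (liftSub σ 1))
        = (fun i => (liftSub σ 3 i.succ).subst (E.diagSub (A.subst σ))) := by
      funext i
      refine Fin.cases rfl (fun i => Fin.cases rfl (fun i => ?_) i) i
      change (σ i).wk = ((σ i).wk.wk.wk).subst _
      rw [Expr.wk_subst, Expr.wk_subst, Expr.wk_subst, Expr.wk_eq_subst]
      rfl
    refine morphismEq_snoc.2 ⟨?_, ?_⟩
    · rw [← e₀]
      exact MorphismEq.refl (mor_snoc.1 hα).1
    · have := E.refl_subst hw h₁ (isElem_var_zero hA)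
      have e₁ : A.wk.subst (liftSub σ 1) = (A.subst σ).wk := by
        rw [Expr.wk_subst, Expr.wk, Expr.ren_subst]
        rfl
      rw [e₁] at this
      refine T.eqElem_conv this (T.eqType_symm ?_)
      have h₄ := E.Id_subst hw (mor_snoc.1 hα).1 (isType_wk_wk hA) (isElem_var_one hA)
        (isElem_var_zero' hA)
      have e₂ : A.wk.wk.subst (fun i => (E.diagSub A i.succ).subst (liftSub σ 1))
          = (A.subst σ).wk := by
        rw [Expr.wk_subst, Expr.wk_subst, Expr.wk, Expr.ren_subst]
        rfl
      rw [e₂] at h₄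
      exact h₄
  obtain ⟨c, e'⟩ := append_congr hw hα hβ e hΘ
  have hwα := Wf.append_subst hw hα hΘ
  have hwβ := Wf.append_subst hw hβ hΘ
  have hd₁ := isElem_subst (Wf.append_subst hw h₁ (T.wf_of_derivable hd))
    (Mor.liftSub hw h₁ (T.wf_of_derivable hd)) hd
  rw [Tele.subst_subst, Expr.subst_liftSub_subst] at hd₁
  have hβ' := CtxEq.mor_congr hwβ hwα hΘ hΘ (CtxEq.symm hwα hwβ c)
      (CtxEq.refl hΘ) (Mor.liftSub hw hβ hΘ)
  have hd₂ := T.isElem_conv hd₁ (T.subst_eqType hwα (Mor.liftSub hw hα hΘ) hβ' e' hC)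
  have hd₃ := c.derivable hwα hwβ hd₂
  rw [Tele.subst_subst, Expr.subst_liftSub_subst]
  exact hd₃

/-- The reflexivity map `(Γ, x ∈ A) ⟶ (Γ, x ∈ A, y ∈ A, u ∈ Id(x, y))` is good. -/
theorem good_diagSub : Good T.displayMaps
    (hom (Wf.snoc hA) (wf_idCtx hA) (E.diagSub A) (mor_diagSub hA)) := by
  refine good_hom_of_liftSub fun {k} Θ hΘ => classA_hom_iff.2 fun C d hC hd => ?_
  have hΓ' := wf_idCtx (E := E) hA
  have hw := Wf.snoc hA
  have h2 : T.Wf ((Γ.snoc A).snoc A.wk) := hΓ'.1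
  have hw₃ : T.Mor (E.idCtx Γ A) Γ (fun i => .var i.succ.succ.succ) :=
    Mor.comp hΓ' (Mor.wk hΓ') (Mor.comp h2 (Mor.wk h2) (Mor.wk hw))
  have hdiag := mor_diagSub (E := E) hA
  -- The elimination rule is applied to the generic triple `(x, y, u)` in the context declaring it,
  -- and the computation rule to `x` in `(Γ, x ∈ A)`. Both require the premisses weakened to these
  -- contexts.
  obtain ⟨hC', hd'⟩ := elimination_premisses_subst hA hΓ' hw₃ hC hd
  obtain ⟨hC'', hd''⟩ := elimination_premisses_subst hA hw (Mor.wk hw) hC hd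
  have eA : A.subst (fun i => .var i.succ.succ.succ) = A.wk.wk.wk := by
    simp only [Expr.wk_eq_subst, Expr.subst_subst]
    rfl
  have ha : T.Derivable (E.idCtx Γ A) (.isElem (.var 2)
      (A.subst (fun i => .var i.succ.succ.succ))) := by
    rw [eA]
    exact isElem_wk hΓ'.2 (isElem_var_one hA)
  have hb : T.Derivable (E.idCtx Γ A) (.isElem (.var 1)
      (A.subst (fun i => .var i.succ.succ.succ))) := by
    rw [eA]
    exact isElem_wk hΓ'.2 (isElem_var_zero' hA)
  have hp : T.Derivable (E.idCtx Γ A) (.isElem (.var 0)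
      (E.Id (A.subst (fun i => .var i.succ.succ.succ)) (.var 2) (.var 1))) := by
    refine T.isElem_conv (isElem_var_zero hΓ'.2) ?_
    rw [eA, Expr.wk_eq_subst, Expr.wk_eq_subst A.wk.wk]
    exact E.Id_subst hΓ' (Mor.wk hΓ') (isType_wk_wk hA) (isElem_var_one hA) (isElem_var_zero' hA)
  have ht := E.elimination ha hb hp hC' hd'
  have hJ := E.J_subst hw hdiag ha hb hp hC' hd'
  have hv : T.Derivable (Γ.snoc A) (.isElem (.var 0) (A.subst fun i => .var i.succ)) := by
    rw [← Expr.wk_eq_subst]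
    exact isElem_var_zero hA
  have hc := E.computation hv hC'' hd''
  -- Weakening followed by instantiation at the generic triple is the identity, so the conclusion of
  -- the rule is an element of `C` itself.
  have e₁ : (fun i => (liftSub (fun i : Fin n => (Expr.var i.succ.succ.succ : Expr S (n + 3))) 3
      i).subst (inst3 (.var 2) (.var 1) (.var 0))) = Expr.var := by
    funext i
    refine Fin.cases rfl (fun i => Fin.cases rfl (fun i => Fin.cases rfl (fun i => rfl) i) i) i
  have e₂ : (fun i => (liftSub (fun i : Fin n => (Expr.var i.succ : Expr S (n + 1))) 3
      i).subst (inst3 (.var 0) (.var 0) (E.refl (A.subst fun i => .var i.succ) (.var 0))))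
        = E.diagSub A := by
    funext i
    rw [← Expr.wk_eq_subst]
    refine Fin.cases rfl (fun i => Fin.cases rfl (fun i => Fin.cases rfl (fun i => rfl) i) i) i
  have e₃ : (fun i => (liftSub (fun i : Fin n => (Expr.var i.succ : Expr S (n + 1))) 1
      i).subst (scons (.var 0) Expr.var)) = Expr.var := by
    funext i
    refine Fin.cases rfl (fun i => rfl) i
  simp only [Tele.subst_subst, Expr.subst_liftSub_subst, e₁, Tele.subst_var, liftSub_var,
    Expr.subst_var] at ht
  refine ⟨_, ht, ?_⟩
  simp only [Tele.subst_subst, Expr.subst_liftSub_subst, e₂, e₃, liftSub_var, Expr.subst_var]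
    at hc
  simp only [Tele.subst_subst, Expr.subst_liftSub_subst, e₁, Tele.subst_var, liftSub_var,
    Expr.subst_var] at hJ
  have e₅ : (Expr.var 0).subst (E.diagSub A)
      = E.refl (A.subst fun i => .var i.succ) (.var 0) := by
    rw [← Expr.wk_eq_subst]
    rfl
  -- Restricted along `(x, x, r(x))`, the J-term becomes the instance to which the computation rule
  -- applies.
  rw [liftSub_comp, liftSub_comp, Expr.subst_subst, e₅] at hJ
  exact T.eqElem_trans hJ hc

end

end IdentityTypes

end DependentTypeTheory

/-! ### Isomorphisms and squares of fibrations -/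

namespace DisplayClass

universe v w

variable {C : Type w} [Category.{v} C] {D : MorphismProperty C}

theorem Good.of_isIso {X Z : C} (f : X ⟶ Z) [IsIso f] : Good D f := by
  intro P Y q g p _ h
  have := h.isIso_snd_of_isIso
  exact MorphismProperty.llp_of_isIso _ _

/-- The square of a fibration is a fibration. -/
theorem Fib.prod (hD : HasBaseChange D) {V A VV AA : C} {π₁ π₂ : VV ⟶ V} {σ₁ σ₂ : AA ⟶ A}
    (hV : IsLimit (BinaryFan.mk π₁ π₂)) (hA : IsLimit (BinaryFan.mk σ₁ σ₂)) {d : A ⟶ V}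
    {dd : AA ⟶ VV} (hd₁ : dd ≫ π₁ = σ₁ ≫ d) (hd₂ : dd ≫ π₂ = σ₂ ≫ d) (hd : Fib D d) :
    Fib D dd := by
  -- `A × A` is built over `V × V` by adjoining the two coordinates in turn, each by a base change
  -- of `d`; `φ` identifies it with the given product.
  obtain ⟨P, q, g, hq, h⟩ := Fib.exists_isPullback hD π₁ hd
  obtain ⟨P', q', g', hq', h'⟩ := Fib.exists_isPullback hD (q ≫ π₂) hd
  obtain ⟨ψ, hψ₁, hψ₂⟩ := BinaryFan.IsLimit.lift' hA (q' ≫ g) g'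
  have hψ₁ : ψ ≫ σ₁ = _ := hψ₁
  have hψ₂ : ψ ≫ σ₂ = _ := hψ₂
  have exV : ∀ {W : C} {a b : W ⟶ VV}, a ≫ π₁ = b ≫ π₁ → a ≫ π₂ = b ≫ π₂ → a = b :=
    fun h₁ h₂ => BinaryFan.IsLimit.hom_ext hV h₁ h₂
  have exA : ∀ {W : C} {a b : W ⟶ AA}, a ≫ σ₁ = b ≫ σ₁ → a ≫ σ₂ = b ≫ σ₂ → a = b :=
    fun h₁ h₂ => BinaryFan.IsLimit.hom_ext hA h₁ h₂
  let χ : AA ⟶ P := h.lift dd σ₁ hd₁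
  have hχ₁ : χ ≫ q = dd := h.lift_fst _ _ _
  have hχ₂ : χ ≫ g = σ₁ := h.lift_snd _ _ _
  let φ : AA ⟶ P' := h'.lift χ σ₂ (by rw [reassoc_of% hχ₁, hd₂])
  have hφ₁ : φ ≫ q' = χ := h'.lift_fst _ _ _
  have hφ₂ : φ ≫ g' = σ₂ := h'.lift_snd _ _ _
  have hψχ : ψ ≫ χ = q' := h.hom_ext
    (exV
      (by rw [Category.assoc, Category.assoc, reassoc_of% hχ₁, hd₁, reassoc_of% hψ₁, Category.assoc,
        h.w])
      (by rw [Category.assoc, Category.assoc, reassoc_of% hχ₁, hd₂, reassoc_of% hψ₂, Category.assoc,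
        h'.w]))
    (by rw [Category.assoc, hχ₂, hψ₁])
  have : IsIso φ := ⟨ψ, exA
    (by rw [Category.assoc, hψ₁, reassoc_of% hφ₁, hχ₂, Category.id_comp])
    (by rw [Category.assoc, hψ₂, hφ₂, Category.id_comp]),
    h'.hom_ext (by rw [Category.assoc, hφ₁, hψχ, Category.id_comp])
      (by rw [Category.assoc, hφ₂, hψ₂, Category.id_comp])⟩
  have e : dd = φ ≫ q' ≫ q := by rw [reassoc_of% hφ₁, hχ₁]
  rw [e]
  exact (Fib.of_isIso φ).trans (hq'.trans hq)

end DisplayClass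

/-! ### Types of variables in concatenated contexts -/

namespace TypeTheory

variable {S : Signature.{u}}

theorem Ctx.append_get_addNat_subst {m n k : ℕ} (Γ : Ctx S n) (Φ : Tele S n k) (i : Fin n)
    (σ : Fin (n + k) → Expr S m) :
    ((Γ.append Φ).get (i.addNat k)).subst σ = (Γ.get i).subst (fun j => σ (j.addNat k)) := by
  induction Φ with
  | nil => rfl
  | snoc Φ A ih => exact (Expr.wk_subst _ _).trans (ih fun j => σ j.succ)

theorem Ctx.append_toTele_get_castLE_subst {m n k : ℕ} (Γ : Ctx S n) (Ψ : Ctx S k) (i : Fin k)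
    (σ : Fin (n + k) → Expr S m) :
    ((Γ.append (Ψ.toTele n)).get (i.castLE (Nat.le_add_left k n))).subst σ
      = (Ψ.get i).subst (fun j => σ (j.castLE (Nat.le_add_left k n))) := by
  induction Ψ with
  | nil => exact i.elim0
  | snoc Ψ A ih =>
    refine Fin.cases ?_ (fun i => ?_) i
    · refine (Expr.wk_subst _ _).trans ((Expr.subst_ren _ _ _).trans ?_)
      exact (Expr.wk_subst A fun j => σ (j.castLE _)).symm
    · refine (Expr.wk_subst _ _).trans ((ih i fun j => σ j.succ).trans ?_)
      exact (Expr.wk_subst (Ψ.get i) fun j => σ (j.castLE _)).symm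

theorem liftSub_eq_sappend {m n k : ℕ} (σ : Fin m → Expr S n) :
    liftSub σ k = sappend (fun i => (σ i).ren (Fin.addNat · k)) (sndVars n k) := by
  have h := funext fun i => liftSub_subst_sappend σ (fstVars n k) (sndVars n k) i
  have e : sappend (fstVars n k) (sndVars n k) = (Expr.var : _ → Expr S (n + k)) :=
    eq_sappend Expr.var
  simp only [e, Expr.subst_var] at h
  change liftSub σ k = _ at h
  rw [h]
  congr 1
  funext i
  conv_rhs => rw [← Expr.subst_var (σ i), Expr.ren_subst]
  rfl

end TypeTheory

namespace DependentTypeTheory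

variable {S : Signature.{u}} {T : DependentTypeTheory S}

open DisplayClass

/-! ### Products of contexts -/

section

variable {m n : ℕ} {Ξ : Ctx S m} {Ψ : Ctx S n}

theorem mor_dup_iff {σ : Fin (n + n) → Expr S m} :
    T.Mor Ξ Ψ.dup σ ↔ T.Mor Ξ Ψ (fun i => σ (i.addNat n)) ∧
      T.Mor Ξ Ψ (fun i => σ (i.castLE (Nat.le_add_left n n))) := by
  constructor
  · intro h
    refine ⟨fun i => ?_, fun i => ?_⟩
    · rw [← Ctx.append_get_addNat_subst Ψ (Ψ.toTele n) i σ]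
      exact h _
    · rw [← Ctx.append_toTele_get_castLE_subst Ψ Ψ i σ]
      exact h _
  · rintro ⟨h₁, h₂⟩
    refine forall_fin_add (fun i => ?_) (fun i => ?_)
    · rw [Ctx.dup, Ctx.append_get_addNat_subst Ψ (Ψ.toTele n) i σ]
      exact h₁ i
    · rw [Ctx.dup, Ctx.append_toTele_get_castLE_subst Ψ Ψ i σ]
      exact h₂ i

theorem morphismEq_dup_iff {σ τ : Fin (n + n) → Expr S m} :
    T.MorphismEq Ξ Ψ.dup σ τ ↔
      T.MorphismEq Ξ Ψ (fun i => σ (i.addNat n)) (fun i => τ (i.addNat n)) ∧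
      T.MorphismEq Ξ Ψ (fun i => σ (i.castLE (Nat.le_add_left n n)))
        (fun i => τ (i.castLE (Nat.le_add_left n n))) := by
  constructor
  · intro h
    refine ⟨fun i => ?_, fun i => ?_⟩
    · rw [← Ctx.append_get_addNat_subst Ψ (Ψ.toTele n) i σ]
      exact h _
    · rw [← Ctx.append_toTele_get_castLE_subst Ψ Ψ i σ]
      exact h _
  · rintro ⟨h₁, h₂⟩
    refine forall_fin_add (fun i => ?_) (fun i => ?_)
    · rw [Ctx.dup, Ctx.append_get_addNat_subst Ψ (Ψ.toTele n) i σ]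
      exact h₁ i
    · rw [Ctx.dup, Ctx.append_toTele_get_castLE_subst Ψ Ψ i σ]
      exact h₂ i

theorem mor_sappend_dup {f g : Fin n → Expr S m} (hf : T.Mor Ξ Ψ f) (hg : T.Mor Ξ Ψ g) :
    T.Mor Ξ Ψ.dup (sappend f g) :=
  mor_dup_iff.2 ⟨by simpa using hf, by simpa using hg⟩

end

theorem mor_append_sndVars {m n : ℕ} {Γ : Ctx S m} {Ψ : Ctx S n}
    (h : T.Wf (Γ.append (Ψ.toTele m))) : T.Mor (Γ.append (Ψ.toTele m)) Ψ (sndVars m n) := by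
  intro i
  have := T.var h (i.castLE (Nat.le_add_left n m))
  rw [← Expr.subst_var ((Γ.append _).get _), Ctx.append_toTele_get_castLE_subst] at this
  exact this

theorem wf_append_toTele {m n : ℕ} {Γ : Ctx S m} {Ψ : Ctx S n} (hΓ : T.Wf Γ) (hΨ : T.Wf Ψ) :
    T.Wf (Γ.append (Ψ.toTele m)) := by
  induction Ψ with
  | nil => exact hΓ
  | snoc Ψ A ih =>
    have e : A.subst (sndVars m _) = A.ren (Fin.castLE (Nat.le_add_left _ m)) := by
      conv_rhs => rw [← A.subst_var, Expr.ren_subst]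
      rfl
    have h := isType_subst (ih hΨ.1) (mor_append_sndVars (ih hΨ.1)) hΨ.2
    rw [e] at h
    exact Wf.snoc h

section

variable {n : ℕ} {Ψ : Ctx S n} (hΨ : T.Wf Ψ)

include hΨ

theorem wf_dup : T.Wf Ψ.dup :=
  wf_append_toTele hΨ hΨ

theorem mor_fstVars : T.Mor Ψ.dup Ψ (fstVars n n) :=
  (mor_dup_iff.1 (Mor.id (wf_dup hΨ))).1

theorem mor_sndVars : T.Mor Ψ.dup Ψ (sndVars n n) :=
  (mor_dup_iff.1 (Mor.id (wf_dup hΨ))).2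

end

/-- The first projection `(x ∈ Ψ, y ∈ Ψ) ⟶ Ψ`. -/
abbrev dupFst {n : ℕ} {Ψ : Ctx S n} (hΨ : T.Wf Ψ) : ob Ψ.dup (wf_dup hΨ) ⟶ ob Ψ hΨ :=
  hom (wf_dup hΨ) hΨ (fstVars n n) (mor_fstVars hΨ)

/-- The second projection `(x ∈ Ψ, y ∈ Ψ) ⟶ Ψ`. -/
abbrev dupSnd {n : ℕ} {Ψ : Ctx S n} (hΨ : T.Wf Ψ) : ob Ψ.dup (wf_dup hΨ) ⟶ ob Ψ hΨ :=
  hom (wf_dup hΨ) hΨ (sndVars n n) (mor_sndVars hΨ)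

theorem exists_dup_lift {n : ℕ} {Ψ : Ctx S n} (hΨ : T.Wf Ψ) {X : ClassifyingCat T}
    (f g : X ⟶ ob Ψ hΨ) :
    ∃ l : X ⟶ ob Ψ.dup (wf_dup hΨ), l ≫ dupFst hΨ = f ∧ l ≫ dupSnd hΨ = g := by
  obtain ⟨l, Ξ, hΞ, rfl⟩ := exists_eq_ob X
  obtain ⟨α, hα, rfl⟩ := exists_eq_hom f
  obtain ⟨β, hβ, rfl⟩ := exists_eq_hom g
  refine ⟨hom hΞ _ _ (mor_sappend_dup hα hβ), ?_, ?_⟩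
  · rw [hom_comp]
    exact hom_congr _ _ (funext fun i => sappend_addNat _ _ _)
  · rw [hom_comp]
    exact hom_congr _ _ (funext fun i => sappend_castLE _ _ _ _)

/-- The context `(x ∈ Ψ, y ∈ Ψ)` is a product. -/
noncomputable def isLimitDup {n : ℕ} {Ψ : Ctx S n} (hΨ : T.Wf Ψ) :
    IsLimit (BinaryFan.mk (dupFst hΨ) (dupSnd hΨ)) :=
  BinaryFan.IsLimit.mk _ (fun f g => (exists_dup_lift hΨ f g).choose)
    (fun f g => (exists_dup_lift hΨ f g).choose_spec.1)
    (fun f g => (exists_dup_lift hΨ f g).choose_spec.2)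
    (by
      intro X f g m h₁ h₂
      replace h₁ := h₁.trans (exists_dup_lift hΨ f g).choose_spec.1.symm
      replace h₂ := h₂.trans (exists_dup_lift hΨ f g).choose_spec.2.symm
      revert h₁ h₂
      generalize (exists_dup_lift hΨ f g).choose = l
      intro h₁ h₂
      obtain ⟨k, Ξ, hΞ, rfl⟩ := exists_eq_ob X
      obtain ⟨α, hα, rfl⟩ := exists_eq_hom l
      obtain ⟨β, hβ, rfl⟩ := exists_eq_hom m
      have h₁ : hom _ _ _ _ ≫ dupFst hΨ = hom _ _ _ _ ≫ dupFst hΨ := h₁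
      have h₂ : hom _ _ _ _ ≫ dupSnd hΨ = hom _ _ _ _ ≫ dupSnd hΨ := h₂
      rw [hom_comp, hom_comp, hom_eq_iff] at h₁ h₂
      exact hom_eq_iff.2 (morphismEq_dup_iff.2 ⟨h₁, h₂⟩))

/-! ### Dependent elements and definitional equality -/

/-- Each type of the telescope depends on the earlier components, so definitional equality of the
extended substitutions is carried through the induction to convert the next component. -/
theorem IsDepElem.congr {m n k : ℕ} {Ξ : Ctx S m} {Γ : Ctx S n} {Φ : Tele S n k}
    {σ τ : Fin n → Expr S m} {a : Fin k → Expr S m} (hΞ : T.Wf Ξ) (hσ : T.Mor Ξ Γ σ)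
    (hτ : T.Mor Ξ Γ τ) (e : T.MorphismEq Ξ Γ σ τ) (h : T.Wf (Γ.append Φ))
    (ha : T.IsDepElem Ξ (Φ.subst σ) a) :
    T.IsDepElem Ξ (Φ.subst τ) a ∧
      T.MorphismEq Ξ (Γ.append Φ) (sappend σ a) (sappend τ a) := by
  induction Φ with
  | nil => exact ⟨trivial, e⟩
  | snoc Φ A ih =>
    obtain ⟨ha₁, ha₂⟩ := ha
    obtain ⟨h₁, h₂⟩ := ih h.1 ha₁
    have hc := T.subst_eqType hΞ (mor_append.2 ⟨hσ, ha₁⟩) (mor_append.2 ⟨hτ, h₁⟩) h₂ h.2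
    simp only [Expr.subst_liftSub_sappend, Expr.subst_var] at ha₂
    refine ⟨⟨h₁, ?_⟩, morphismEq_snoc.2 ⟨h₂, T.eqElem_refl ha₂⟩⟩
    simp only [Expr.subst_liftSub_sappend, Expr.subst_var]
    exact T.isElem_conv ha₂ hc

/-- `Id` is a bare operation on expressions with no congruence rule. Congruence is recovered by
substituting definitionally equal triples in the generic type `Id(x, y)`. -/
theorem IdentityTypes.Id_congr {E : T.IdentityTypes} {n : ℕ} {Γ : Ctx S n} {A a a' b : Expr S n}
    (ha : T.Derivable Γ (.eqElem a a' A)) (hb : T.Derivable Γ (.isElem b A)) :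
    T.Derivable Γ (.eqType (E.Id A a b) (E.Id A a' b)) := by
  have hA := T.isType_of_isElem hb
  have hΓ := T.wf_of_derivable hA
  have mor : ∀ {c}, T.Derivable Γ (.isElem c A) →
      T.Mor Γ ((Γ.snoc A).snoc A.wk) (scons b (scons c Expr.var)) ∧
      T.Derivable Γ (.eqType ((E.Id A.wk.wk (.var 1) (.var 0)).subst
        (scons b (scons c Expr.var))) (E.Id A c b)) := by
    intro c hc
    have e : A.wk.wk.subst (scons b (scons c Expr.var)) = A := by
      rw [Expr.wk_subst, Expr.wk_subst]
      exact Expr.subst_var _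
    have h₁ : T.Mor Γ (Γ.snoc A) (scons c Expr.var) := by
      refine Mor.scons (Mor.id hΓ) ?_
      rw [Expr.subst_var]
      exact hc
    have h₂ : T.Mor Γ ((Γ.snoc A).snoc A.wk) (scons b (scons c Expr.var)) := by
      refine Mor.scons h₁ ?_
      rw [Expr.wk_subst]
      change T.Derivable Γ (.isElem b (A.subst Expr.var))
      rw [Expr.subst_var]
      exact hb
    refine ⟨h₂, ?_⟩
    have := E.Id_subst hΓ h₂ (isType_wk_wk hA) (isElem_var_one hA) (isElem_var_zero' hA)
    rw [e] at this
    exact this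
  obtain ⟨h₁, h₂⟩ := mor (T.isElem_left ha)
  obtain ⟨h₁', h₂'⟩ := mor (T.isElem_right ha)
  refine T.eqType_trans (T.eqType_symm h₂) (T.eqType_trans (T.subst_eqType hΓ h₁ h₁' ?_
    (E.formation (isType_wk_wk hA) (isElem_var_one hA) (isElem_var_zero' hA))) h₂')
  refine morphismEq_snoc.2 ⟨morphismEq_snoc.2 ⟨MorphismEq.refl (Mor.id hΓ), ?_⟩, ?_⟩
  · change T.Derivable Γ (.eqElem a a' (A.subst Expr.var))
    rw [Expr.subst_var]
    exact ha
  · rw [Expr.wk_subst]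
    change T.Derivable Γ (.eqElem b b (A.subst Expr.var))
    rw [Expr.subst_var]
    exact T.eqElem_refl hb

end DependentTypeTheory

namespace DependentTypeTheory

variable {S : Signature.{u}} {T : DependentTypeTheory S}

open DisplayClass

/-! ### Identity contexts -/

/-- The reflexivity map `x ↦ (x, x, r(x))`. -/
abbrev reflSub {n : ℕ} (r : Fin n → Expr S n) : Fin (n + n + n) → Expr S n :=
  sappend (sappend Expr.var Expr.var) r

/-- The dependent context `I` relative to `(x ∈ Ψ, y ∈ Ψ)` and the elements `r` of `I(x, x)` give a
good path object of `Ψ`. -/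
def IsGoodIdentity (T : DependentTypeTheory S) {n : ℕ} (Ψ : Ctx S n) (I : Tele S (n + n) n)
    (r : Fin n → Expr S n) : Prop :=
  ∃ (hΨ : T.Wf Ψ) (hI : T.Wf (Ψ.dup.append I)) (hr : T.Mor Ψ (Ψ.dup.append I) (reflSub r)),
    Good T.displayMaps (hom hΨ hI (reflSub r) hr)

/-- The morphism `((x, x'), (y, y')) ↦ (x, y)`. -/
abbrev dupProj (S : Signature.{u}) (n : ℕ) : Fin (n + n) → Expr S (n + 1 + (n + 1)) :=
  sappend (fun i => fstVars (n + 1) (n + 1) i.succ) (fun i => sndVars (n + 1) (n + 1) i.succ)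

/-- The morphism `(x, x', y') ↦ ((x, x'), (x, y'))`. -/
abbrev dupOver (S : Signature.{u}) (n : ℕ) : Fin (n + 1 + (n + 1)) → Expr S (n + 2) :=
  sappend (fun i => .var i.succ) (liftSub (fun i => .var i.succ) 1)

section

variable {n : ℕ} {Ψ : Ctx S n} {A : Expr S n} (hΨ : T.Wf (Ψ.snoc A))

include hΨ

theorem mor_dupProj : T.Mor (Ψ.snoc A).dup Ψ.dup (dupProj S n) :=
  mor_sappend_dup (mor_snoc.1 (mor_fstVars hΨ)).1 (mor_snoc.1 (mor_sndVars hΨ)).1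

theorem mor_lift_wk :
    T.Mor ((Ψ.snoc A).snoc A.wk) (Ψ.snoc A) (liftSub (fun i => .var i.succ) 1) := by
  refine Mor.lift_one (Mor.wk hΨ) ?_
  rw [← Expr.wk_eq_subst]
  exact T.eqType_refl (isType_wk hΨ.2 hΨ.2)

theorem mor_dupOver : T.Mor ((Ψ.snoc A).snoc A.wk) (Ψ.snoc A).dup (dupOver S n) :=
  mor_sappend_dup (Mor.wk (Wf.snoc (isType_wk hΨ.2 hΨ.2))) (mor_lift_wk hΨ)

theorem fib_dupProj : Fib T.displayMaps (hom (wf_dup hΨ) (wf_dup hΨ.1) _ (mor_dupProj hΨ)) := by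
  refine Fib.prod hasBaseChange (isLimitDup hΨ.1) (isLimitDup hΨ) (d := disp hΨ) ?_ ?_
    (Fib.of_mem _ (displayMaps_disp hΨ))
  · rw [hom_comp, hom_comp]
    exact hom_congr _ _ (funext fun i => sappend_addNat _ _ _)
  · rw [hom_comp, hom_comp]
    exact hom_congr _ _ (funext fun i => sappend_castLE _ _ _ _)

/-- Over the diagonal of `Ψ`, a pair of points of `(Ψ, A)` amounts to a point of `Ψ` and two
elements of the same fibre of `A`. -/
theorem isPullback_dupOver :
    IsPullback (disp (Wf.snoc (isType_wk hΨ.2 hΨ.2)) ≫ disp hΨ)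
      (hom (Wf.snoc (isType_wk hΨ.2 hΨ.2)) (wf_dup hΨ) _ (mor_dupOver hΨ))
      (hom hΨ.1 (wf_dup hΨ.1) _ (mor_sappend_dup (Mor.id hΨ.1) (Mor.id hΨ.1)))
      (hom (wf_dup hΨ) (wf_dup hΨ.1) _ (mor_dupProj hΨ)) := by
  have hB : T.Derivable (Ψ.snoc A) (.eqType A.wk (A.subst fun i => .var i.succ)) := by
    rw [← Expr.wk_eq_subst]
    exact T.eqType_refl (isType_wk hΨ.2 hΨ.2)
  refine isPullback_diagonal (isLimitDup hΨ.1) (isLimitDup hΨ)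
    (isPullback_disp hΨ (Mor.wk hΨ) hB (Wf.snoc (isType_wk hΨ.2 hΨ.2)) hΨ) ?_ ?_ ?_ ?_ ?_ ?_
  · rw [hom_comp, hom_comp]
    exact hom_congr _ _ (funext fun i => sappend_addNat _ _ _)
  · rw [hom_comp, hom_comp]
    exact hom_congr _ _ (funext fun i => sappend_castLE _ _ _ _)
  · rw [hom_comp, ← hom_var]
    exact hom_congr _ _ (funext fun i => sappend_addNat _ _ _)
  · rw [hom_comp, ← hom_var]
    exact hom_congr _ _ (funext fun i => sappend_castLE _ _ _ _)
  · rw [hom_comp]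
    exact hom_congr _ _ (funext fun i => sappend_addNat _ _ _)
  · rw [hom_comp]
    exact hom_congr _ _ (funext fun i => sappend_castLE _ _ _ _)

end

section

variable {n : ℕ} {Ψ : Ctx S n} {A : Expr S n} {I : Tele S (n + n) n} {r : Fin n → Expr S n}
  (hΨ : T.Wf (Ψ.snoc A)) (hI : T.Wf (Ψ.dup.append I))
  (hr : T.Mor Ψ (Ψ.dup.append I) (reflSub r))

/-- The morphism `(x, x', y') ↦ ((x, x'), (x, y'), r(x))`. -/
abbrev reflOver (r : Fin n → Expr S n) : Fin (n + 1 + (n + 1) + n) → Expr S (n + 2) :=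
  sappend (dupOver S n) (fun i => (r i).wk.wk)

theorem dupOver_dupProj : (fun i => (dupProj S n i).subst (dupOver S n))
    = sappend (fun i => .var i.succ.succ) (fun i => .var i.succ.succ) := by
  funext i
  rw [sappend_subst]
  congr 1
  · funext i
    exact sappend_addNat _ _ _
  · funext i
    exact sappend_castLE _ _ _ _

theorem reflOver_liftSub : (fun i => (liftSub (dupProj S n) n i).subst (reflOver r))
    = fun i => (reflSub r i).subst (fun i => .var i.succ.succ) := by
  funext i
  rw [liftSub_subst_sappend, dupOver_dupProj, sappend_subst]
  congr 1
  · funext i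
    rw [sappend_subst]
    rfl
  · funext i
    simp only [Expr.wk_eq_subst, Expr.subst_subst]
    rfl

include hΨ hI in
theorem wf_append_dupProj : T.Wf ((Ψ.snoc A).dup.append (I.subst (dupProj S n))) :=
  Wf.append_subst (wf_dup hΨ) (mor_dupProj hΨ) hI

include hΨ hr in
theorem mor_reflOver : T.Mor ((Ψ.snoc A).snoc A.wk)
    ((Ψ.snoc A).dup.append (I.subst (dupProj S n))) (reflOver r) := by
  refine mor_append.2 ⟨mor_dupOver hΨ, ?_⟩
  have hw := Wf.snoc (isType_wk hΨ.2 hΨ.2)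
  have := Mor.comp hw (Mor.comp hw (Mor.wk hw) (Mor.wk hΨ)) hr
  rw [Tele.subst_subst, dupOver_dupProj]
  have e : (fun i => (reflSub r i).subst (fun i => .var i.succ.succ))
      = sappend (sappend (fun i => .var i.succ.succ) (fun i => .var i.succ.succ))
        (fun i => (r i).wk.wk) := by
    rw [← reflOver_liftSub]
    funext i
    rw [liftSub_subst_sappend, dupOver_dupProj]
  exact (mor_append.1 (e ▸ this)).2

/-- The square is pasted with the pullback defining the identity telescope over `(Ψ, A)`. The outer
rectangle lies over the diagonal of `Ψ`, where it is `isPullback_dupOver`. -/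
theorem isPullback_reflOver :
    IsPullback (disp (Wf.snoc (isType_wk hΨ.2 hΨ.2)) ≫ disp hΨ)
      (hom (Wf.snoc (isType_wk hΨ.2 hΨ.2)) (wf_append_dupProj hΨ hI) _ (mor_reflOver hΨ hr))
      (hom hΨ.1 hI _ hr)
      (hom (wf_append_dupProj hΨ hI) hI _ (Mor.liftSub (wf_dup hΨ) (mor_dupProj hΨ) hI)) := by
  refine (IsPullback.of_right (h₁₂ := proj (wf_dup hΨ) (wf_append_dupProj hΨ hI))
    (h₂₂ := proj (wf_dup hΨ.1) hI)
    (v₁₃ := hom (wf_dup hΨ) (wf_dup hΨ.1) _ (mor_dupProj hΨ)) ?_ ?_ ?_).flip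
  · convert (isPullback_dupOver hΨ).flip using 1
    · rw [hom_comp]
      exact hom_congr _ _ (funext fun i => sappend_addNat _ _ _)
    · rw [hom_comp]
      exact hom_congr _ _ (funext fun i => sappend_addNat _ _ _)
  · rw [hom_comp, hom_comp, hom_comp]
    exact hom_congr _ _ reflOver_liftSub
  · exact isPullback_proj (wf_dup hΨ) (wf_dup hΨ.1) (mor_dupProj hΨ) _ hI

/-- Adjoining one more type `B`, later the identity type between `u_!(x')` and `y'`, again gives a
pullback of the reflexivity map of `Ψ`. It is taken along a fibration, which forgets `x'`, `y'` and
the variable of type `B`. -/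
theorem good_reflOver (hg : Good T.displayMaps (hom hΨ.1 hI _ hr))
    {B : Expr S (n + 1 + (n + 1) + n)}
    (hB : T.Wf (((Ψ.snoc A).dup.append (I.subst (dupProj S n))).snoc B))
    {B' : Expr S (n + 2)} (hB' : T.Wf (((Ψ.snoc A).snoc A.wk).snoc B'))
    (e : T.Derivable ((Ψ.snoc A).snoc A.wk) (.eqType B' (B.subst (reflOver r)))) :
    Good T.displayMaps (hom hB' hB _ (Mor.lift_one (mor_reflOver hΨ hr) e)) := by
  refine hg.of_isPullback
    ((isPullback_disp hB'.1 (mor_reflOver hΨ hr) e hB' hB).paste_horiz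
      (isPullback_reflOver hΨ hI hr)) ?_
  refine Fib.comp _ _ (displayMaps_disp hB) ?_
  exact Fib.of_isPullback hasBaseChange
    (isPullback_proj (wf_dup hΨ) (wf_dup hΨ.1) (mor_dupProj hΨ) (wf_append_dupProj hΨ hI) hI).flip
    (fib_dupProj hΨ)

end

/-- The morphism `((x, x'), (y, y'), u) ↦ (x, y, u, x')`. -/
abbrev transportSub (S : Signature.{u}) (n : ℕ) :
    Fin (n + n + n + 1) → Expr S (n + 1 + (n + 1) + n) :=
  scons ((fstVars (n + 1) (n + 1) 0).ren (Fin.addNat · n))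
    (sappend (sappend (fun i => (fstVars (n + 1) (n + 1) i.succ).ren (Fin.addNat · n))
      (fun i => (sndVars (n + 1) (n + 1) i.succ).ren (Fin.addNat · n)))
      (sndVars (n + 1 + (n + 1)) n))

theorem transportSub_succ (n : ℕ) :
    (fun i => transportSub S n i.succ) = liftSub (dupProj S n) n := by
  rw [liftSub_eq_sappend]
  have : (fun i => (dupProj S n i).ren (Fin.addNat · n)) =
      sappend (fun i => (fstVars (n + 1) (n + 1) i.succ).ren (Fin.addNat · n))
      (fun i => (sndVars (n + 1) (n + 1) i.succ).ren (Fin.addNat · n)) := by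
    funext i
    refine forall_fin_add (P := fun i => (dupProj S n i).ren (Fin.addNat · n) = sappend _ _ i)
      (fun i => ?_) (fun i => ?_) i <;> simp
  rw [this]
  rfl

/-- Factor the reflexivity map through `(x ∈ Ψ, x' ∈ A, y' ∈ A, u' ∈ Id(x', y'))`. The first factor
is good by J in `A`, and the second is a pullback of the reflexivity map of `Ψ` along a fibration.
-/
theorem IsGoodIdentity.snoc {E : T.IdentityTypes} {n : ℕ} {Ψ : Ctx S n} {I : Tele S (n + n) n}
    {r : Fin n → Expr S n} (h : T.IsGoodIdentity Ψ I r) {A : Expr S n}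
    (hA : T.Derivable Ψ (.isType A)) {t : Expr S (n + n + n + 1)}
    (ht : T.Derivable
      ((Ψ.dup.append I).snoc (A.subst (fun i => .var ((i.addNat n).addNat n))))
      (.isElem t (A.subst (fun i => .var (((i.castLE (Nat.le_add_left n n)).addNat n).succ)))))
    (ht_refl : T.Derivable (Ψ.snoc A)
      (.eqElem (t.subst (scons (.var 0)
        (sappend (sappend (fun i => .var i.succ) (fun i => .var i.succ)) (fun i => (r i).wk))))
        (.var 0) A.wk)) :
    T.IsGoodIdentity (Ψ.snoc A)
      (Tele.snoc (I.subst (dupProj S n))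
        (E.Id (A.subst (fun i => (sndVars (n + 1) (n + 1) i.succ).ren (Fin.addNat · n)))
          (t.subst (transportSub S n))
          ((sndVars (n + 1) (n + 1) 0).ren (Fin.addNat · n))))
      (scons (E.refl A.wk (.var 0)) (fun i => (r i).wk)) := by
  obtain ⟨hΨ, hI, hr, hg⟩ := h
  have hΨ' := Wf.snoc hA
  have hQ := wf_append_dupProj hΨ' hI
  have hw := (Mor.wkAppend _ hQ).2
  have hfst := Mor.comp hQ hw (mor_fstVars hΨ')
  have hsnd := Mor.comp hQ hw (mor_sndVars hΨ')
  have hfst₂ := (mor_snoc.1 hfst).2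
  obtain ⟨hsnd₁, hsnd₂⟩ : T.Mor _ Ψ (fun i => (sndVars (n + 1) (n + 1) i.succ).ren
      (Fin.addNat · n)) ∧ T.Derivable _ (.isElem ((sndVars (n + 1) (n + 1) 0).ren (Fin.addNat · n))
      (A.subst fun i => (sndVars (n + 1) (n + 1) i.succ).ren (Fin.addNat · n))) :=
    mor_snoc.1 hsnd
  have hτ : T.Mor ((Ψ.snoc A).dup.append (I.subst (dupProj S n)))
      ((Ψ.dup.append I).snoc (A.subst (fun i => .var ((i.addNat n).addNat n))))
      (transportSub S n) := by
    refine mor_snoc.2 ⟨?_, ?_⟩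
    · rw [transportSub_succ]
      exact Mor.liftSub (wf_dup hΨ') (mor_dupProj hΨ') hI
    · rw [Expr.subst_subst]
      have e : (fun i : Fin n => (Expr.var (S := S) (((i.addNat n).addNat n).succ)).subst
          (transportSub S n)) = fun i => (fstVars (n + 1) (n + 1) i.succ).ren (Fin.addNat · n) :=
        funext fun i => (sappend_addNat _ _ _).trans (sappend_addNat _ _ _)
      exact e ▸ hfst₂
  have ha := isElem_subst hQ hτ ht
  rw [Expr.subst_subst] at ha
  have eB : (fun i : Fin n => (Expr.var (S := S)
      (((i.castLE (Nat.le_add_left n n)).addNat n).succ)).subst (transportSub S n))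
      = fun i => (sndVars (n + 1) (n + 1) i.succ).ren (Fin.addNat · n) :=
    funext fun i => (sappend_addNat _ _ _).trans (sappend_castLE _ _ _ _)
  rw [eB] at ha
  have hB := isType_subst hQ hsnd₁ hA
  have hId := E.formation hB ha hsnd₂
  have hw2 := Wf.snoc (isType_wk hA hA)
  have hρ := mor_reflOver hΨ' hr
  have e₁ := E.Id_subst hw2 hρ hB ha hsnd₂
  have e₂ : (A.subst fun i => (sndVars (n + 1) (n + 1) i.succ).ren (Fin.addNat · n)).subst
      (reflOver r) = A.wk.wk := by
    have e : (fun i : Fin n => ((sndVars (S := S) (n + 1) (n + 1) i.succ).ren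
        (Fin.addNat · n)).subst (reflOver r)) = fun i => .var i.succ.succ :=
      funext fun i => (sappend_addNat _ _ _).trans (sappend_castLE _ _ i.succ _)
    rw [Expr.subst_subst, e, Expr.wk_eq_subst, Expr.wk_eq_subst, Expr.subst_subst]
    rfl
  have e₃ : ((sndVars (n + 1) (n + 1) 0).ren (Fin.addNat · n)).subst (reflOver r) = .var 0 :=
    (sappend_addNat _ _ _).trans (sappend_castLE _ _ 0 _)
  have e₄ : (t.subst (transportSub S n)).subst (reflOver r) = (t.subst (scons (.var 0)
        (sappend (sappend (fun i => .var i.succ) (fun i => .var i.succ)) (fun i => (r i).wk)))).wk := by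
    rw [Expr.wk_eq_subst, Expr.subst_subst, Expr.subst_subst]
    congr 1
    funext i
    refine Fin.cases ?_ (fun i => ?_) i
    · exact (sappend_addNat _ _ _).trans (sappend_addNat _ _ 0)
    · refine (congrArg (fun e => Expr.subst e _) (congrFun (transportSub_succ n) i)).trans ?_
      refine (congrFun (reflOver_liftSub (r := r)) i).trans ?_
      change _ = (sappend (sappend _ _) _ i).subst _
      simp only [sappend_subst, Expr.wk_eq_subst, Expr.subst_subst, Expr.subst]
  -- Over reflexivity the last declaration becomes `Id(r(x)_!(x'), y')`. The computation rule for
  -- transport identifies this with `Id(x', y')`, so the two factors compose.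
  have e₅ : T.Derivable ((Ψ.snoc A).snoc A.wk) (.eqType (E.Id A.wk.wk (.var 1) (.var 0))
      ((E.Id (A.subst (fun i => (sndVars (n + 1) (n + 1) i.succ).ren (Fin.addNat · n)))
          (t.subst (transportSub S n))
          ((sndVars (n + 1) (n + 1) 0).ren (Fin.addNat · n))).subst (reflOver r))) := by
    have h₁ := eqElem_subst hw2 (Mor.wk hw2) ht_refl
    simp only [← Expr.wk_eq_subst] at h₁
    rw [← e₄] at h₁
    have h₂ := IdentityTypes.Id_congr (E := E) h₁ (IdentityTypes.isElem_var_zero' hA)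
    rw [e₂, e₃] at e₁
    exact T.eqType_trans (T.eqType_symm h₂) (T.eqType_symm e₁)
  have hP := Wf.snoc hId
  have hcomp := (IdentityTypes.good_diagSub (E := E) hA).trans hasBaseChange
    (good_reflOver hΨ' hI hr hg hP (IdentityTypes.wf_idCtx hA) e₅)
  rw [hom_comp] at hcomp
  have e₆ : (fun i => (liftSub (reflOver r) 1 i).subst (E.diagSub A))
      = reflSub (scons (E.refl A.wk (.var 0)) (fun i => (r i).wk)) := by
    funext i
    refine Fin.cases rfl (fun i => ?_) i
    refine (Expr.wk_subst _ _).trans ?_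
    change (sappend (dupOver S n) _ i).subst _
      = sappend (sappend Expr.var Expr.var) (fun i => (r i).wk) i
    rw [sappend_subst]
    congr 1
    · funext i
      rw [sappend_subst]
      congr 1
      funext i
      exact Fin.cases rfl (fun i => rfl) i
    · funext i
      rw [Expr.wk_subst]
      exact Expr.subst_var _
  -- The substitution is generalised because the typing proof inside `hom` depends on it and
  -- prevents direct rewriting.
  have key : ∀ (σ : Fin (n + 1 + (n + 1) + (n + 1)) → Expr S (n + 1)) (hσ : T.Mor _ _ σ),
      σ = reflSub (scons (E.refl A.wk (.var 0)) (fun i => (r i).wk)) →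
      Good T.displayMaps (hom hΨ' hP σ hσ) → ∃ hr, Good T.displayMaps (hom hΨ' hP
        (reflSub (scons (E.refl A.wk (.var 0)) (fun i => (r i).wk))) hr) := by
    rintro _ h rfl g
    exact ⟨h, g⟩
  exact ⟨hΨ', hP, key _ _ e₆ hcomp⟩

/-- Identity contexts give good path objects. -/
theorem isGoodIdentity {E : T.IdentityTypes} {n : ℕ} {Ψ : Ctx S n} {I : Tele S (n + n) n}
    {r : Fin n → Expr S n} (h : E.IsIdentityContext Ψ I r) (hΨ : T.Wf Ψ) :
    T.IsGoodIdentity Ψ I r := by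
  induction h with
  | nil =>
    have hr : T.Mor (Ctx.nil (S := S)) (Ctx.nil.dup.append Tele.nil) (reflSub Fin.elim0) :=
      fun i => i.elim0
    refine ⟨trivial, trivial, hr, ?_⟩
    have e : hom (T := T) (Γ := Ctx.nil) (Δ := Ctx.nil) trivial trivial (reflSub Fin.elim0) hr
        = 𝟙 _ :=
      isTerminalNil.hom_ext _ _
    have := Good.of_isIso (D := T.displayMaps) (𝟙 (ob (T := T) Ctx.nil trivial))
    rw [← e] at this
    exact this
  | snoc h A t ht ht_refl ih => exact (ih hΨ.1).snoc hΨ.2 ht ht_refl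

/-- Adjoining `z ∈ A(x)` pulls the reflexivity map back along a display map, so the pullback is an
`𝒜`-map. The section `z` of `A(y)`, defined where `y = x`, therefore extends to all paths. -/
theorem IsGoodIdentity.exists_transport {n : ℕ} {Ψ : Ctx S n} {I : Tele S (n + n) n}
    {r : Fin n → Expr S n} (h : T.IsGoodIdentity Ψ I r) {A : Expr S n}
    (hA : T.Derivable Ψ (.isType A)) : ∃ t : Expr S (n + n + n + 1), T.Derivable
      ((Ψ.dup.append I).snoc (A.subst (fun i => .var ((i.addNat n).addNat n))))
      (.isElem t (A.subst (fun i => .var (((i.castLE (Nat.le_add_left n n)).addNat n).succ)))) ∧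
      T.Derivable (Ψ.snoc A) (.eqElem (t.subst (scons (.var 0)
        (sappend (sappend (fun i => .var i.succ) (fun i => .var i.succ)) (fun i => (r i).wk))))
        (.var 0) A.wk) := by
  obtain ⟨hΨ, hI, hr, hg⟩ := h
  have hw := (Mor.wkAppend _ hI).2
  have hB := isType_subst hI (Mor.comp hI hw (mor_fstVars hΨ)) hA
  have hB' := isType_subst hI (Mor.comp hI hw (mor_sndVars hΨ)) hA
  have e : (A.subst fun i : Fin n => .var ((i.addNat n).addNat n)).subst (reflSub r) = A := by
    rw [Expr.subst_subst]
    refine Eq.trans (congrArg _ (funext fun i => ?_)) A.subst_var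
    exact (sappend_addNat _ _ _).trans (sappend_addNat _ _ _)
  have hA' : T.Derivable Ψ (.eqType A
      ((A.subst fun i : Fin n => .var ((i.addNat n).addNat n)).subst (reflSub r))) := by
    rw [e]
    exact T.eqType_refl hA
  have hl := hg _ _ _ (Fib.of_mem _ (displayMaps_disp (Wf.snoc hB)))
    (isPullback_disp hΨ hr hA' (Wf.snoc hA) (Wf.snoc hB))
  have hB₂ := isType_subst (Wf.snoc hB) (Mor.wk (Wf.snoc hB)) hB'
  rw [Expr.subst_subst] at hB₂
  have e' : ((A.subst fun i : Fin n => .var (((i.castLE (Nat.le_add_left n n)).addNat n).succ)).subst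
      (liftSub (reflSub r) 1)) = A.wk := by
    rw [Expr.subst_subst, Expr.wk_eq_subst]
    refine congrArg _ (funext fun i => ?_)
    exact congrArg Expr.wk ((sappend_addNat _ _ _).trans (sappend_castLE _ _ _ _))
  have e'' : scons (.var 0) (sappend (sappend (fun i => .var i.succ) (fun i => .var i.succ))
      (fun i => (r i).wk)) = liftSub (reflSub r) 1 := by
    funext i
    refine Fin.cases rfl (fun i => ?_) i
    change sappend (sappend _ _) _ i = (sappend (sappend _ _) _ i).wk
    simp only [sappend_subst, Expr.wk_eq_subst, Expr.subst]
  obtain ⟨t, ht, ht'⟩ := classA_hom_iff.1 hl _ (.var 0) hB₂ (by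
    refine (congrArg (fun B => T.Derivable _ (.isElem (.var 0) B)) e').mpr ?_
    exact isElem_var_zero hA)
  refine ⟨t, ht, ?_⟩
  rw [e'', ← e']
  exact ht'

theorem exists_isIdentityContext (E : T.IdentityTypes) {n : ℕ} {Ψ : Ctx S n} (hΨ : T.Wf Ψ) :
    ∃ I r, E.IsIdentityContext Ψ I r := by
  induction Ψ with
  | nil => exact ⟨_, _, .nil⟩
  | snoc Ψ A ih =>
    obtain ⟨I, r, h⟩ := ih hΨ.1
    obtain ⟨t, ht, ht'⟩ := (isGoodIdentity h hΨ.1).exists_transport hΨ.2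
    exact ⟨_, _, .snoc h A t ht ht'⟩

/-- The path object given by an identity context. -/
noncomputable def identityPath {n : ℕ} {Ψ : Ctx S n} {I : Tele S (n + n) n}
    {r : Fin n → Expr S n} (hΨ : T.Wf Ψ) (hI : T.Wf (Ψ.dup.append I))
    (hr : T.Mor Ψ (Ψ.dup.append I) (reflSub r)) (hg : Good T.displayMaps (hom hΨ hI _ hr)) :
    GoodPath T.displayMaps (ob Ψ hΨ) where
  prod := ob Ψ.dup (wf_dup hΨ)
  π₁ := dupFst hΨ
  π₂ := dupSnd hΨ
  isProduct := isLimitDup hΨ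
  path := ob _ hI
  r := hom hΨ hI _ hr
  p := proj (wf_dup hΨ) hI
  fac₁ := by
    rw [hom_comp, hom_comp, ← hom_var]
    exact hom_congr _ _ (funext fun i => (sappend_addNat _ _ _).trans (sappend_addNat _ _ _))
  fac₂ := by
    rw [hom_comp, hom_comp, ← hom_var]
    exact hom_congr _ _ (funext fun i => (sappend_addNat _ _ _).trans (sappend_castLE _ _ _ _))
  good := hg
  fib := fib_proj _ hI

theorem nonempty_goodPath (E : T.IdentityTypes) (Y : ClassifyingCat T) :
    Nonempty (GoodPath T.displayMaps Y) := by
  obtain ⟨n, Ψ, hΨ, rfl⟩ := exists_eq_ob Y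
  obtain ⟨I, r, h⟩ := exists_isIdentityContext E hΨ
  obtain ⟨hΨ, hI, hr, hg⟩ := isGoodIdentity h hΨ
  exact ⟨identityPath hΨ hI hr hg⟩

theorem identityPath_homotopic_iff {m n : ℕ} {Ψ : Ctx S n} {I : Tele S (n + n) n}
    {r : Fin n → Expr S n} (hΨ : T.Wf Ψ) (hI : T.Wf (Ψ.dup.append I))
    (hr : T.Mor Ψ (Ψ.dup.append I) (reflSub r)) (hg : Good T.displayMaps (hom hΨ hI _ hr))
    {Φ : Ctx S m} (hΦ : T.Wf Φ) {f g : Fin n → Expr S m} (hf : T.Mor Φ Ψ f) (hg' : T.Mor Φ Ψ g) :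
    (identityPath hΨ hI hr hg).toPathObject.Homotopic (hom hΦ hΨ f hf) (hom hΦ hΨ g hg') ↔
      T.PropositionallyEqual Φ I f g := by
  constructor
  · rintro ⟨(h : ob Φ hΦ ⟶ ob _ hI), h₁, h₂⟩
    obtain ⟨γ, hγ, rfl⟩ := exists_eq_hom h
    replace h₁ : hom hΦ hI γ hγ ≫ proj (wf_dup hΨ) hI ≫ dupFst hΨ = _ := h₁
    replace h₂ : hom hΦ hI γ hγ ≫ proj (wf_dup hΨ) hI ≫ dupSnd hΨ = _ := h₂
    rw [hom_comp, hom_comp, hom_eq_iff] at h₁ h₂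
    obtain ⟨hγ₁, hγ₂⟩ := Mor.append_iff.1 hγ
    -- The endpoints of the homotopy are only definitionally equal to `f` and `g`, so its last
    -- components are converted to the identity telescope at `(f, g)`.
    refine ⟨_, (hγ₂.congr hΦ hγ₁ (mor_sappend_dup hf hg') (morphismEq_dup_iff.2 ⟨?_, ?_⟩) hI).1⟩
    · simp only [sappend_addNat]
      exact h₁
    · simp only [sappend_castLE]
      exact h₂
  · rintro ⟨p, hp⟩
    refine ⟨hom hΦ hI _ (mor_append.2 ⟨mor_sappend_dup hf hg', hp⟩), ?_, ?_⟩
    · change hom hΦ hI _ _ ≫ proj (wf_dup hΨ) hI ≫ dupFst hΨ = _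
      rw [hom_comp, hom_comp]
      exact hom_congr _ _ (funext fun i => (sappend_addNat _ _ _).trans (sappend_addNat _ _ _))
    · change hom hΦ hI _ _ ≫ proj (wf_dup hΨ) hI ≫ dupSnd hΨ = _
      rw [hom_comp, hom_comp]
      exact hom_congr _ _ (funext fun i => (sappend_addNat _ _ _).trans (sappend_castLE _ _ _ _))

end DependentTypeTheory

/-! ### The main theorem -/

theorem mainTheorem5 {S : TypeTheory.Signature.{u}} (T : DependentTypeTheory S)
    (E : T.IdentityTypes) :
    -- pullbacks along dependent projections exist
    (∀ {X Y Z : T.ClassifyingCat} (f : X ⟶ Z) (p : Y ⟶ Z),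
      T.IsDependentProjection p → HasPullback f p) ∧
    -- pullbacks of `𝒜`-maps along dependent projections are `𝒜`-maps
    (∀ {P X Y Z : T.ClassifyingCat} {q : P ⟶ X} {g : P ⟶ Y} {f : X ⟶ Z} {p : Y ⟶ Z},
      IsPullback q g f p → T.IsDependentProjection p → T.classA f → T.classA g) ∧
    -- the homotopy relation is defined and transitive
    (∀ Y : T.ClassifyingCat, Nonempty (PathObject T.classA T.classB Y) ∧
      ∀ (P : PathObject T.classA T.classB Y) {X : T.ClassifyingCat} (f g h : X ⟶ Y),
        P.Homotopic f g → P.Homotopic g h → P.Homotopic f h) ∧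
    -- the homotopy relation is pointwise propositional equality
    (∀ {n : ℕ} (Ψ : TypeTheory.Ctx S n) (hΨ : T.Wf Ψ),
      (∃ I r, E.IsIdentityContext Ψ I r) ∧
      ∀ I r, E.IsIdentityContext Ψ I r →
        ∀ (P : PathObject T.classA T.classB (DependentTypeTheory.ob Ψ hΨ))
          {m : ℕ} (Φ : TypeTheory.Ctx S m) (hΦ : T.Wf Φ)
          (f g : Fin n → TypeTheory.Expr S m) (hf : T.Mor Φ Ψ f) (hg : T.Mor Φ Ψ g),
          P.Homotopic (DependentTypeTheory.hom hΦ hΨ f hf) (DependentTypeTheory.hom hΦ hΨ g hg) ↔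
            T.PropositionallyEqual Φ I f g) := by
  obtain hD := DependentTypeTheory.hasBaseChange (T := T)
  have hO := DependentTypeTheory.isTerminalNil (T := T)
  refine ⟨fun f p hp => ?_, fun {P X Y Z q g f p} h hp hf => ?_, fun Y => ⟨?_, ?_⟩,
    fun {n} Ψ hΨ => ⟨DependentTypeTheory.exists_isIdentityContext E hΨ, ?_⟩⟩
  · obtain ⟨_, _, _, _, h⟩ := DisplayClass.Fib.exists_isPullback hD f hp.fib
    exact h.hasPullback
  · obtain ⟨Q⟩ := DependentTypeTheory.nonempty_goodPath E Z
    -- The path object is one of the codomain `Z` of the `𝒜`-map, along which the deformation takes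
    -- place.
    exact Q.good_of_llp hD hO DependentTypeTheory.fib_to_nil hf q g p hp.fib h
  · obtain ⟨Q⟩ := DependentTypeTheory.nonempty_goodPath E Y
    exact ⟨Q.toPathObject⟩
  · intro P X f g h h₁ h₂
    obtain ⟨Q⟩ := DependentTypeTheory.nonempty_goodPath E Y
    exact DisplayClass.homotopic_of_homotopic _ _ (Q.homotopic_trans hD hO
      DependentTypeTheory.fib_to_nil (DisplayClass.homotopic_of_homotopic _ _ h₁)
      (DisplayClass.homotopic_of_homotopic _ _ h₂))
  · intro I r hIr P m Φ hΦ f g hf hg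
    obtain ⟨hΨ, hI, hr, hgood⟩ := DependentTypeTheory.isGoodIdentity hIr hΨ
    rw [← DependentTypeTheory.identityPath_homotopic_iff hΨ hI hr hgood hΦ hf hg]
    exact ⟨DisplayClass.homotopic_of_homotopic _ _, DisplayClass.homotopic_of_homotopic _ _⟩
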